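/- Let $K\ge 2$ be fixed and let $Y$ be a categorical variable with values $L_1,\dots,L_K$ and fixed probabilities $p_k=P(Y=L_k)>0$. For each $m\ge 1$ let $(X_1,Y_1),\dots,(X_n,Y_n)$, $n=n(m)$, be i.i.d. copies of a pair $(X,Y)$, where $X=X^{(m)}$ is a random vector in $\mathbb R^{p}$, $p=p(m)$, with law $F=F^{(m)}$ and $X$ is independent of $Y$. Let $n_k$ be the number of indices $i$ with $Y_i=L_k$, let $\hat p_k=n_k/n$, let $\hat\Delta$ be the average of $\|X_i-X_j\|$ (Euclidean norm) over all pairs $i<j$, let $\hat\Delta_k$ be the average over the pairs $i<j$ with $Y_i=Y_j=L_k$, and put $$\mathrm{gCov}_n(X,Y)=\hat\Delta-\sum_{k=1}^K\hat p_k\hat\Delta_k .$$ With $X,X'$ independent of law $F$ let $d(x,y)=\|x-y\|-\mathbb E\|x-X\|-\mathbb E\|X-y\|+\mathbb E\|X-X'\|$. From now on let $X_1,\dots,X_4$ also denote independent variables of law $F$ wherever they appear under an expectation. Assume $\mathbb E d^2(X_1,X_2)>0$ (that is, $X$ is not almost surely constant) for every $m$, and * (C1) $\mathbb E\|X\|^4<\infty$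 for every $m$; * (C2) $\dfrac{\mathbb E d^4(X_1,X_2)}{n\,(\mathbb E d^2(X_1,X_2))^2}\to 0$; * (C3) $\dfrac{\mathbb E\, d(X_1,X_3)d(X_2,X_3)d(X_1,X_4)d(X_2,X_4)}{(\mathbb E d^2(X_1,X_2))^2}\to 0$ as $m\to\infty$. Let $$\hat\sigma_0^2=\Big(\sum_{k=1}^K\hat p_k^2\tbinom{n_k}{2}^{-1}-\tbinom n2^{-1}\Big)V_n^2(X),\qquad V_n^2(X)=\frac1{n(n-3)}\sum_{1\le k\ne l\le n}A_{k,l}^2,$$ $$A_{k,l}=\|X_k-X_l\|-\frac1{n-2}\sum_{i=1}^n\|X_i-X_l\|-\frac1{n-2}\sum_{j=1}^n\|X_k-X_j\|+\frac1{(n-1)(n-2)}\sum_{i,j=1}^n\|X_i-X_j\| .$$ If, as $m\to\infty$, $p\to\infty$ and $\min_k n_k\to\infty$ in probability, then $$\frac{\mathrm{gCov}_n(X,Y)}{\hat\sigma_0}\ \xrightarrow{\ d\ }\ \mathcal N(0,1).$$ The same holds when the labels $Y_1,\dots,Y_n$ in $\mathrm{gCov}_n$ and $\hat\sigma_0$ are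 replaced by any non-random labels (with $X_1,\dots,X_n$ i.i.d. of law $F$) for which $p\to\infty$, $\min_k n_k\to\infty$, and, for some $c>0$, $n_k\ge c\,n$ for all $k$ and all large $m$. -/

import Mathlib

open MeasureTheory ProbabilityTheory Filter Topology

noncomputable section

namespace GiniCov

/-- The double centered distance `d(x, y)` of a law `F` on `ℝ^p`:
`‖x - y‖ - E‖x - X‖ - E‖X - y‖ + E‖X - X'‖` with `X, X'` independent of law `F`. -/
def dcd {p : ℕ} (F : Measure (EuclideanSpace ℝ (Fin p))) (x y : EuclideanSpace ℝ (Fin p)) : ℝ :=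
  ‖x - y‖ - (∫ z, ‖x - z‖ ∂F) - (∫ z, ‖z - y‖ ∂F) + ∫ z, ∫ w, ‖z - w‖ ∂F ∂F

/-- `E d(X₁, X₂) ^ r` for independent `X₁, X₂` of law `F`. -/
def dcdMoment {p : ℕ} (F : Measure (EuclideanSpace ℝ (Fin p))) (r : ℕ) : ℝ :=
  ∫ x₁, ∫ x₂, dcd F x₁ x₂ ^ r ∂F ∂F

/-- `E d(X₁, X₃) d(X₂, X₃) d(X₁, X₄) d(X₂, X₄)` for independent `X₁, …, X₄` of law `F`. -/
def dcdCycle {p : ℕ} (F : Measure (EuclideanSpace ℝ (Fin p))) : ℝ :=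
  ∫ x₁, ∫ x₂, ∫ x₃, ∫ x₄,
    dcd F x₁ x₃ * dcd F x₂ x₃ * dcd F x₁ x₄ * dcd F x₂ x₄ ∂F ∂F ∂F ∂F

/-- The indices of the sample points with label `k`. -/
def cls {n K : ℕ} (y : Fin n → Fin K) (k : Fin K) : Finset (Fin n) :=
  Finset.univ.filter fun i => y i = k

/-- The class size `n_k`. -/
def clsSize {n K : ℕ} (y : Fin n → Fin K) (k : Fin K) : ℕ := (cls y k).card

/-- The `U`-statistic estimating the Gini mean difference from the sample points with index
in `S`: the average of `‖x i - x j‖` over the pairs `i < j` in `S`. -/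
def gmdU {p n : ℕ} (x : Fin n → EuclideanSpace ℝ (Fin p)) (S : Finset (Fin n)) : ℝ :=
  (S.card.choose 2 : ℝ)⁻¹ * ∑ i ∈ S, ∑ j ∈ S.filter (fun j => i < j), ‖x i - x j‖

/-- The sample Gini covariance of the data `(x i, y i)`, with `n_k / n` estimating the
probability of class `k`. -/
def gCovn {p n K : ℕ} (x : Fin n → EuclideanSpace ℝ (Fin p)) (y : Fin n → Fin K) : ℝ :=
  gmdU x Finset.univ - ∑ k, ((clsSize y k : ℝ) / n) * gmdU x (cls y k)

/-- The centered sample distance `A_{k,l}`. -/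
def centDist {p n : ℕ} (x : Fin n → EuclideanSpace ℝ (Fin p)) (k l : Fin n) : ℝ :=
  ‖x k - x l‖ - 1 / ((n : ℝ) - 2) * ∑ i, ‖x i - x l‖ - 1 / ((n : ℝ) - 2) * ∑ j, ‖x k - x j‖
    + 1 / (((n : ℝ) - 1) * ((n : ℝ) - 2)) * ∑ i, ∑ j, ‖x i - x j‖

/-- The bias-corrected squared sample distance variance `V_n²`. -/
def dVarn {p n : ℕ} (x : Fin n → EuclideanSpace ℝ (Fin p)) : ℝ :=
  1 / ((n : ℝ) * ((n : ℝ) - 3)) *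
    ∑ k, ∑ l ∈ Finset.univ.filter (fun l => k ≠ l), centDist x k l ^ 2

/-- The estimated variance `σ̂₀²`. -/
def varHat {p n K : ℕ} (x : Fin n → EuclideanSpace ℝ (Fin p)) (y : Fin n → Fin K) : ℝ :=
  (∑ k, ((clsSize y k : ℝ) / n) ^ 2 * ((clsSize y k).choose 2 : ℝ)⁻¹ - (n.choose 2 : ℝ)⁻¹)
    * dVarn x

/-- The studentized sample Gini covariance `gCov_n / σ̂₀`. -/
def studGCov {p n K : ℕ} (x : Fin n → EuclideanSpace ℝ (Fin p)) (y : Fin n → Fin K) : ℝ :=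
  gCovn x y / √(varHat x y)

end GiniCov

end

/-! The overall average and the class averages both give each sample point total weight 2/n, so
gCov_n is a quadratic form in the distances whose off-diagonal weights sum to zero along every row.
Functions of a single point therefore cancel, and the distance may be replaced by the doubly
centered kernel d. Put m = E d² and let v be `weightVar y`. Division by σ = √(v m) turns gCov_n into
a degenerate statistic T, the sum of w_ij d(x_i, x_j) over unordered pairs, with E T² = 1.

Normality of T comes from Stein's method applied to the characteristic function ψ. Let R_j (`row`)
collect the terms of T that contain point j, and let T - R_j (`rest`) be the remainder. Then T = ½ Σ
R_j, and E R_j exp(it(T - R_j)) = 0 because d is centered. Expanding exp(-itR_j) to first order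
gives ψ'(t) + tψ(t) = 0 up to ½|t| E|Σ R_j² - 2| + ½t² Σ E|R_j|³ (`norm_deriv_add_mul_le`), and an
integrating factor turns this into a bound on ψ(t) - exp(-t²/2) (`norm_sub_gaussian_le`).

Both errors are controlled by counting index patterns. A product of kernel values has mean zero as
soon as some index occurs once. What survives in the variance of Σ R_j² is of order W⁴(n³ E d⁴ + n⁴
|cycle|), where W bounds the weights, and Σ E R_j⁴ is of order W⁴ n³ E d⁴. If n_k ≥ cn for all k,
the unnormalized weights are O(n⁻²) while v ≥ 2/n², so W⁴n⁴ = O(m⁻²) and the bounds become exactly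
the ratios in (C2) and (C3).

The same counting shows that V_n²/m tends to 1 in L¹ (`integral_abs_dVarn_sub_le`), which permits
studentization. All bounds are uniform over labels with n_k ≥ cn. Fixed labels are then immediate.
Random labels are independent of the X sample and satisfy the proportion bound off a set of small
probability by Chebyshev, so one averages over them. -/

namespace GiniCov

/-! ### Resampling one coordinate of an i.i.d. sample -/

section Update

variable {ι E G : Type*} [Fintype ι] [DecidableEq ι] [MeasurableSpace E]
  [NormedAddCommGroup G] [NormedSpace ℝ G]

omit [Fintype ι] in
theorem measurable_update_uncurry (a : ι) :
    Measurable (fun q : (ι → E) × E => Function.update q.1 a q.2) := by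
  refine measurable_pi_lambda _ fun i => ?_
  by_cases h : i = a
  · subst h; simpa using measurable_snd
  · simp only [Function.update_of_ne h]; fun_prop

/-- Resampling one coordinate of an i.i.d. sample does not change its law. -/
theorem measurePreserving_update (F : Measure E) [IsProbabilityMeasure F] (a : ι) :
    MeasurePreserving (fun q : (ι → E) × E => Function.update q.1 a q.2)
      ((Measure.pi fun _ => F).prod F) (Measure.pi fun _ => F) := by
  refine ⟨measurable_update_uncurry a, ?_⟩
  refine (Measure.pi_eq fun s hs => ?_).symm
  rw [Measure.map_apply (measurable_update_uncurry a) (MeasurableSet.univ_pi hs)]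
  -- The preimage of a box is a box again: the old coordinate `a` becomes free and the new point
  -- takes over its constraint.
  have : (fun q : (ι → E) × E => Function.update q.1 a q.2) ⁻¹' (Set.univ.pi s)
      = (Set.univ.pi (Function.update s a Set.univ)) ×ˢ (s a) := by
    ext ⟨x, z⟩
    simp only [Set.mem_preimage, Set.mem_pi, Set.mem_univ, true_implies, Set.mem_prod]
    constructor
    · intro h
      refine ⟨fun i => ?_, by simpa using h a⟩
      by_cases hi : i = a
      · subst hi; simp
      · simpa [Function.update_of_ne hi] using h i
    · rintro ⟨h1, h2⟩ i
      by_cases hi : i = a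
      · subst hi; simpa using h2
      · simpa [Function.update_of_ne hi] using h1 i
  rw [this, Measure.prod_prod, Measure.pi_pi, ← Finset.mul_prod_erase _ _ (Finset.mem_univ a),
    ← Finset.mul_prod_erase _ (fun i => F (s i)) (Finset.mem_univ a)]
  simp only [Function.update_self, measure_univ, one_mul]
  rw [mul_comm]
  congr 1
  refine Finset.prod_congr rfl fun i hi => ?_
  rw [Function.update_of_ne (Finset.ne_of_mem_erase hi)]

omit [NormedSpace ℝ G] in
theorem integrable_comp_update {F : Measure E} [IsProbabilityMeasure F] (a : ι) {f : (ι → E) → G}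
    (hf : Integrable f (Measure.pi fun _ => F)) :
    Integrable (fun q : (ι → E) × E => f (Function.update q.1 a q.2))
      ((Measure.pi fun _ => F).prod F) :=
  (measurePreserving_update F a).integrable_comp_of_integrable hf

/-- Plays the role of conditioning on all coordinates except `a`. -/
theorem integral_update {F : Measure E} [IsProbabilityMeasure F] (a : ι) {f : (ι → E) → G}
    (hf : Integrable f (Measure.pi fun _ => F)) :
    ∫ x, f x ∂(Measure.pi fun _ => F)
      = ∫ x, ∫ z, f (Function.update x a z) ∂F ∂(Measure.pi fun _ => F) := by
  have h := measurePreserving_update F a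
  rw [← integral_prod _ (integrable_comp_update a hf), ← h.map_eq,
    integral_map h.measurable.aemeasurable (by rw [h.map_eq]; exact hf.1), h.map_eq]

theorem integrable_integral_update {F : Measure E} [IsProbabilityMeasure F] (a : ι)
    {f : (ι → E) → G} (hf : Integrable f (Measure.pi fun _ => F)) :
    Integrable (fun x => ∫ z, f (Function.update x a z) ∂F) (Measure.pi fun _ => F) :=
  (integrable_comp_update a hf).integral_prod_left

/-- No integrability is needed, since a non-integrable function has integral zero by convention. -/
theorem integral_eq_zero_of_update {F : Measure E} [IsProbabilityMeasure F] (a : ι)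
    {f : (ι → E) → G} (h : ∀ x, ∫ z, f (Function.update x a z) ∂F = 0) :
    ∫ x, f x ∂(Measure.pi fun _ => F) = 0 := by
  by_cases hf : Integrable f (Measure.pi fun _ => F)
  · rw [integral_update a hf]; simp [h]
  · exact integral_undef hf

omit [DecidableEq ι] in
theorem measurePreserving_eval_pair (F : Measure E) [IsProbabilityMeasure F] {i j : ι}
    (hij : i ≠ j) :
    MeasurePreserving (fun x : ι → E => (x i, x j)) (Measure.pi fun _ => F) (F.prod F) := by
  refine ⟨by fun_prop, ?_⟩
  have hind : iIndepFun (fun i (x : ι → E) => x i) (Measure.pi fun _ => F) :=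
    iIndepFun_pi (X := fun _ (z : E) => z) fun _ => aemeasurable_id
  have := (indepFun_iff_map_prod_eq_prod_map_map (measurable_pi_apply i).aemeasurable
    (measurable_pi_apply j).aemeasurable).1
    (hind.indepFun hij)
  rw [this]
  congr 1
  · exact (measurePreserving_eval (fun _ : ι => F) i).map_eq
  · exact (measurePreserving_eval (fun _ : ι => F) j).map_eq

omit [DecidableEq ι] in
theorem indepFun_eval_pair (F : Measure E) [IsProbabilityMeasure F] {i j k l : ι}
    (hik : i ≠ k) (hil : i ≠ l) (hjk : j ≠ k) (hjl : j ≠ l) :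
    IndepFun (fun x : ι → E => (x i, x j)) (fun x : ι → E => (x k, x l))
      (Measure.pi fun _ => F) := by
  have hind : iIndepFun (fun i (x : ι → E) => x i) (Measure.pi fun _ => F) :=
    iIndepFun_pi (X := fun _ (z : E) => z) fun _ => aemeasurable_id
  exact hind.indepFun_prodMk_prodMk (fun i => measurable_pi_apply i) i j k l hik hil hjk hjl

end Update

/-! ### Degenerate kernels and their moments on a sample -/

section Kernel

variable {ι E : Type*} [MeasurableSpace E]

/-- A symmetric kernel with finite fourth moment, centered in each argument. -/
structure IsDegenerate (F : Measure E) (d : E → E → ℝ) : Prop where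
  measurable : Measurable (Function.uncurry d)
  symm : ∀ x y, d x y = d y x
  integral_eq_zero : ∀ x, ∫ z, d x z ∂F = 0
  integrable_pow_four : Integrable (fun q : E × E => d q.1 q.2 ^ 4) (F.prod F)

/-- The `r`-th moment of a kernel at two independent points. -/
noncomputable def kernelMoment (F : Measure E) (d : E → E → ℝ) (r : ℕ) : ℝ :=
  ∫ x, ∫ y, d x y ^ r ∂F ∂F

/-- The mean of the product of a kernel along a cycle of four independent points. -/
noncomputable def kernelCycle (F : Measure E) (d : E → E → ℝ) : ℝ :=
  ∫ x₁, ∫ x₂, ∫ x₃, ∫ x₄, d x₁ x₃ * d x₂ x₃ * d x₁ x₄ * d x₂ x₄ ∂F ∂F ∂F ∂F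

variable [DecidableEq ι]

/-- The kernel matrix of a sample, with zero diagonal. -/
noncomputable def kmat (d : E → E → ℝ) (i j : ι) (x : ι → E) : ℝ :=
  if i = j then 0 else d (x i) (x j)

omit [MeasurableSpace E] in
theorem kmat_of_ne (d : E → E → ℝ) {i j : ι} (h : i ≠ j) (x : ι → E) :
    kmat d i j x = d (x i) (x j) := if_neg h

omit [MeasurableSpace E] in
@[simp] theorem kmat_self (d : E → E → ℝ) (i : ι) (x : ι → E) : kmat d i i x = 0 := if_pos rfl

omit [MeasurableSpace E] in
theorem kmat_update_of_ne (d : E → E → ℝ) {i j a : ι} (hi : i ≠ a) (hj : j ≠ a) (x : ι → E)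
    (z : E) : kmat d i j (Function.update x a z) = kmat d i j x := by
  simp [kmat, Function.update_of_ne hi, Function.update_of_ne hj]

/-- The arithmetic-geometric mean inequality for fourth powers. It reduces integrability and size of
every product of four kernel values to E d⁴. -/
theorem abs_mul_four_le (a b c e : ℝ) :
    |a * b * c * e| ≤ (a ^ 4 + b ^ 4 + c ^ 4 + e ^ 4) / 4 := by
  rw [abs_le]
  constructor <;>
  nlinarith [sq_nonneg (a * b + c * e), sq_nonneg (a * b - c * e), sq_nonneg (a ^ 2 - b ^ 2),
    sq_nonneg (c ^ 2 - e ^ 2)]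

namespace IsDegenerate

variable {F : Measure E} {d : E → E → ℝ} (hd : IsDegenerate F d)
include hd

theorem measurable_comp {Ω : Type*} [MeasurableSpace Ω] {f g : Ω → E} (hf : Measurable f)
    (hg : Measurable g) : Measurable fun ω => d (f ω) (g ω) :=
  hd.measurable.comp (hf.prodMk hg)

theorem measurable_kmat (i j : ι) : Measurable (kmat d i j) := by
  unfold kmat
  by_cases h : i = j
  · simp only [h, if_true]; exact measurable_const
  · simp only [h, if_false]
    exact hd.measurable_comp (measurable_pi_apply i) (measurable_pi_apply j)

theorem kmat_symm (i j : ι) (x : ι → E) : kmat d i j x = kmat d j i x := by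
  unfold kmat
  by_cases h : i = j
  · simp [h]
  · simp [h, Ne.symm h, hd.symm (x i)]

variable [IsProbabilityMeasure F]

theorem integrable_sq : Integrable (fun q : E × E => d q.1 q.2 ^ 2) (F.prod F) := by
  refine ((integrable_const (1 : ℝ)).add hd.integrable_pow_four).mono'
    (hd.measurable.pow_const 2).aestronglyMeasurable (ae_of_all _ fun q => ?_)
  simp only [Real.norm_eq_abs, Pi.add_apply, abs_pow, sq_abs]
  nlinarith [sq_nonneg (d q.1 q.2 ^ 2 - 1), sq_nonneg (d q.1 q.2 ^ 2)]

theorem kernelMoment_four : kernelMoment F d 4 = ∫ q, d q.1 q.2 ^ 4 ∂F.prod F :=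
  (integral_prod _ hd.integrable_pow_four).symm

theorem kernelMoment_two : kernelMoment F d 2 = ∫ q, d q.1 q.2 ^ 2 ∂F.prod F :=
  (integral_prod _ hd.integrable_sq).symm

theorem kernelMoment_four_nonneg : 0 ≤ kernelMoment F d 4 := by
  rw [hd.kernelMoment_four]; exact integral_nonneg fun q => by positivity

theorem kernelMoment_two_nonneg : 0 ≤ kernelMoment F d 2 := by
  rw [hd.kernelMoment_two]; exact integral_nonneg fun q => by positivity

/-- Expand E (d² - E d²)² ≥ 0. -/
theorem kernelMoment_two_sq_le : kernelMoment F d 2 ^ 2 ≤ kernelMoment F d 4 := by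
  rw [hd.kernelMoment_four, hd.kernelMoment_two]
  set c := ∫ q, d q.1 q.2 ^ 2 ∂F.prod F with hc
  have h : 0 ≤ ∫ q, (d q.1 q.2 ^ 4 - (2 * c) * d q.1 q.2 ^ 2 + c ^ 2) ∂F.prod F := by
    refine integral_nonneg fun q => ?_
    simp only [Pi.zero_apply]
    nlinarith [sq_nonneg (d q.1 q.2 ^ 2 - c)]
  have h' : Integrable (fun q : E × E => d q.1 q.2 ^ 4 - (2 * c) * d q.1 q.2 ^ 2) (F.prod F) :=
    hd.integrable_pow_four.sub (hd.integrable_sq.const_mul _)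
  rw [integral_add h' (integrable_const _), integral_sub hd.integrable_pow_four (hd.integrable_sq.const_mul _),
    integral_const_mul, ← hc] at h
  simp at h
  nlinarith

variable [Fintype ι]

theorem integrable_kmat_pow_four (i j : ι) :
    Integrable (fun x => kmat d i j x ^ 4) (Measure.pi fun _ => F) := by
  by_cases h : i = j
  · simp [h]
  · simp only [kmat_of_ne d h]
    exact (measurePreserving_eval_pair F h).integrable_comp_of_integrable hd.integrable_pow_four

theorem integral_kmat_pow_four_le (i j : ι) :
    ∫ x, kmat d i j x ^ 4 ∂(Measure.pi fun _ => F) ≤ kernelMoment F d 4 := by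
  by_cases h : i = j
  · simpa [h] using hd.kernelMoment_four_nonneg
  · simp only [kmat_of_ne d h]
    rw [hd.kernelMoment_four, ← (measurePreserving_eval_pair F h).map_eq,
      integral_map (by fun_prop)]
    exact (hd.measurable.pow_const 4).aestronglyMeasurable

theorem integrable_kmat_sq (i j : ι) :
    Integrable (fun x => kmat d i j x ^ 2) (Measure.pi fun _ => F) := by
  by_cases h : i = j
  · simp [h]
  · simp only [kmat_of_ne d h]
    exact (measurePreserving_eval_pair F h).integrable_comp_of_integrable hd.integrable_sq

theorem integral_kmat_sq {i j : ι} (h : i ≠ j) :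
    ∫ x, kmat d i j x ^ 2 ∂(Measure.pi fun _ => F) = kernelMoment F d 2 := by
  simp only [kmat_of_ne d h]
  rw [hd.kernelMoment_two, ← (measurePreserving_eval_pair F h).map_eq,
    integral_map (by fun_prop)]
  exact (hd.measurable.pow_const 2).aestronglyMeasurable

theorem memLp_kmat (i j : ι) : MemLp (kmat d i j) 2 (Measure.pi fun _ => F) :=
  (memLp_two_iff_integrable_sq (hd.measurable_kmat i j).aestronglyMeasurable).2
    (hd.integrable_kmat_sq i j)

theorem integrable_kmat_mul_four (i₁ j₁ i₂ j₂ i₃ j₃ i₄ j₄ : ι) :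
    Integrable (fun x => kmat d i₁ j₁ x * kmat d i₂ j₂ x * kmat d i₃ j₃ x * kmat d i₄ j₄ x)
      (Measure.pi fun _ => F) := by
  refine Integrable.mono' (((((hd.integrable_kmat_pow_four i₁ j₁).add
    (hd.integrable_kmat_pow_four i₂ j₂)).add (hd.integrable_kmat_pow_four i₃ j₃)).add
    (hd.integrable_kmat_pow_four i₄ j₄)).div_const 4)
    ((((hd.measurable_kmat i₁ j₁).mul (hd.measurable_kmat i₂ j₂)).mul
      (hd.measurable_kmat i₃ j₃)).mul (hd.measurable_kmat i₄ j₄)).aestronglyMeasurable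
    (ae_of_all _ fun x => abs_mul_four_le _ _ _ _)

theorem abs_integral_kmat_mul_four_le (i₁ j₁ i₂ j₂ i₃ j₃ i₄ j₄ : ι) :
    |∫ x, kmat d i₁ j₁ x * kmat d i₂ j₂ x * kmat d i₃ j₃ x * kmat d i₄ j₄ x
      ∂(Measure.pi fun _ => F)| ≤ kernelMoment F d 4 := by
  have i1 := hd.integrable_kmat_pow_four i₁ j₁
  have i2 := hd.integrable_kmat_pow_four i₂ j₂
  have i3 := hd.integrable_kmat_pow_four i₃ j₃
  have i4 := hd.integrable_kmat_pow_four i₄ j₄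
  have h : |∫ x, kmat d i₁ j₁ x * kmat d i₂ j₂ x * kmat d i₃ j₃ x * kmat d i₄ j₄ x
      ∂(Measure.pi fun _ => F)| ≤ ∫ x, (kmat d i₁ j₁ x ^ 4 + kmat d i₂ j₂ x ^ 4
        + kmat d i₃ j₃ x ^ 4 + kmat d i₄ j₄ x ^ 4) / 4 ∂(Measure.pi fun _ => F) := by
    refine abs_integral_le_integral_abs.trans (integral_mono
      (hd.integrable_kmat_mul_four _ _ _ _ _ _ _ _).abs
      ((((i1.add i2).add i3).add i4).div_const 4) fun x => abs_mul_four_le _ _ _ _)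
  have i12 : Integrable (fun x => kmat d i₁ j₁ x ^ 4 + kmat d i₂ j₂ x ^ 4)
    (Measure.pi fun _ => F) := i1.add i2
  have i123 : Integrable (fun x => kmat d i₁ j₁ x ^ 4 + kmat d i₂ j₂ x ^ 4
    + kmat d i₃ j₃ x ^ 4) (Measure.pi fun _ => F) := i12.add i3
  rw [integral_div, integral_add i123 i4, integral_add i12 i3, integral_add i1 i2] at h
  linarith [hd.integral_kmat_pow_four_le i₁ j₁, hd.integral_kmat_pow_four_le i₂ j₂,
    hd.integral_kmat_pow_four_le i₃ j₃, hd.integral_kmat_pow_four_le i₄ j₄]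

/-- An index that occurs only once makes the mean of a product vanish. -/
theorem integral_kmat_smul_eq_zero {G : Type*} [NormedAddCommGroup G] [NormedSpace ℝ G]
    [CompleteSpace G] (a b : ι) {g : (ι → E) → G} (hg : ∀ x z, g (Function.update x a z) = g x) :
    ∫ x, kmat d a b x • g x ∂(Measure.pi fun _ => F) = 0 := by
  by_cases hab : a = b
  · simp [hab]
  -- Resampling point `a` leaves `g` unchanged, and the one remaining factor is centered in that
  -- argument.
  refine integral_eq_zero_of_update a fun x => ?_
  simp only [hg, kmat_of_ne d hab, Function.update_self, Function.update_of_ne (Ne.symm hab)]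
  rw [integral_smul_const]
  simp [hd.symm _ (x b), hd.integral_eq_zero]

theorem integral_kmat_mul_eq_zero (a b : ι) {g : (ι → E) → ℝ}
    (hg : ∀ x z, g (Function.update x a z) = g x) :
    ∫ x, kmat d a b x * g x ∂(Measure.pi fun _ => F) = 0 :=
  hd.integral_kmat_smul_eq_zero a b hg

/-- Integrating out `j` and then `l` produces the same factor g(x, y) = ∫ d(x, z) d(y, z) each time,
so both sides equal E g². In particular the order of integration in `kernelCycle` does not matter.
-/
theorem integral_kmat_cycle {i k j l : ι} (hik : i ≠ k) (hij : i ≠ j) (hkj : k ≠ j) (hil : i ≠ l)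
    (hkl : k ≠ l) (hjl : j ≠ l) :
    ∫ x, kmat d i j x * kmat d k j x * kmat d i l x * kmat d k l x ∂(Measure.pi fun _ => F)
      = kernelCycle F d := by
  set g : E → E → ℝ := fun x y => ∫ z, d x z * d y z ∂F with hg
  have h1 := hd.integrable_kmat_mul_four i j k j i l k l
  have e1 : (fun x : ι → E => ∫ z, kmat d i j (Function.update x j z)
      * kmat d k j (Function.update x j z) * kmat d i l (Function.update x j z)
      * kmat d k l (Function.update x j z) ∂F)
      = fun x => g (x i) (x k) * (d (x i) (x l) * d (x k) (x l)) := by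
    funext x
    simp only [kmat_of_ne d hij, kmat_of_ne d hkj, kmat_of_ne d hil, kmat_of_ne d hkl,
      Function.update_self, Function.update_of_ne hij, Function.update_of_ne hkj,
      Function.update_of_ne hjl.symm, mul_assoc]
    rw [← integral_mul_const]
    simp only [mul_assoc]
  have h2 := integrable_integral_update j h1
  rw [integral_update j h1]
  rw [e1] at h2 ⊢
  have e2 : (fun x : ι → E => ∫ z, g (Function.update x l z i) (Function.update x l z k)
      * (d (Function.update x l z i) (Function.update x l z l)
        * d (Function.update x l z k) (Function.update x l z l)) ∂F)
      = fun x => g (x i) (x k) ^ 2 := by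
    funext x
    simp only [Function.update_self, Function.update_of_ne hil, Function.update_of_ne hkl]
    rw [integral_const_mul, sq]
  have h3 := integrable_integral_update l h2
  rw [integral_update l h2]
  rw [e2] at h3 ⊢
  have hgm : StronglyMeasurable (fun q : E × E => g q.1 q.2) := by
    refine StronglyMeasurable.integral_prod_right (f := fun q : (E × E) => fun z =>
      d q.1 z * d q.2 z) ?_
    exact ((hd.measurable_comp (measurable_fst.comp measurable_fst) measurable_snd).mul
      (hd.measurable_comp (measurable_snd.comp measurable_fst) measurable_snd)).stronglyMeasurable
  have hmp := measurePreserving_eval_pair F hik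
  have h4 : Integrable (fun q : E × E => g q.1 q.2 ^ 2) (F.prod F) := by
    rw [← hmp.map_eq]
    exact (integrable_map_measure (hgm.pow 2).aestronglyMeasurable
      hmp.measurable.aemeasurable).2 h3
  have h5 : ∫ x, g (x i) (x k) ^ 2 ∂(Measure.pi fun _ => F)
      = ∫ q, g q.1 q.2 ^ 2 ∂F.prod F := by
    rw [← hmp.map_eq]
    exact (integral_map hmp.measurable.aemeasurable (hgm.pow 2).aestronglyMeasurable).symm
  rw [h5, integral_prod _ h4, kernelCycle]
  refine integral_congr_ae (ae_of_all _ fun x => integral_congr_ae (ae_of_all _ fun y => ?_))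
  simp only [mul_assoc, integral_const_mul]
  simp only [← mul_assoc, integral_mul_const]
  simp only [hg, sq]

end IsDegenerate

end Kernel

/-! ### Second moments of weighted sums -/

section SecondMoment

variable {α Ω : Type*} [MeasurableSpace Ω] {μ : Measure Ω}

omit [MeasurableSpace Ω] in
theorem sum_mul_sq_eq (s : Finset α) (c : α → ℝ) (Z : α → Ω → ℝ) :
    (fun ω => (∑ a ∈ s, c a * Z a ω) ^ 2)
      = fun ω => ∑ a ∈ s, ∑ b ∈ s, c a * c b * (Z a ω * Z b ω) := by
  funext ω
  rw [sq, Finset.sum_mul_sum]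
  exact Finset.sum_congr rfl fun a _ => Finset.sum_congr rfl fun b _ => by ring

theorem integrable_sum_mul_sq (s : Finset α) (c : α → ℝ) {Z : α → Ω → ℝ}
    (hZ : ∀ a b, Integrable (fun ω => Z a ω * Z b ω) μ) :
    Integrable (fun ω => (∑ a ∈ s, c a * Z a ω) ^ 2) μ := by
  rw [sum_mul_sq_eq]
  exact integrable_finsetSum _ fun a _ => integrable_finsetSum _ fun b _ => (hZ a b).const_mul _

/-- `B` will be a table of indicators of index coincidences, so that bounding a variance becomes a
counting problem. -/
theorem integral_sum_mul_sq_le (s : Finset α) {c : α → ℝ} {Z : α → Ω → ℝ}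
    (hZ : ∀ a b, Integrable (fun ω => Z a ω * Z b ω) μ) {C : ℝ} (hC : ∀ a ∈ s, |c a| ≤ C)
    {B : α → α → ℝ} (hB : ∀ a ∈ s, ∀ b ∈ s, |∫ ω, Z a ω * Z b ω ∂μ| ≤ B a b) :
    ∫ ω, (∑ a ∈ s, c a * Z a ω) ^ 2 ∂μ ≤ C ^ 2 * ∑ a ∈ s, ∑ b ∈ s, B a b := by
  rw [sum_mul_sq_eq, integral_finsetSum _ fun a _ => integrable_finsetSum _ fun b _ =>
    (hZ a b).const_mul _, Finset.mul_sum]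
  refine Finset.sum_le_sum fun a ha => ?_
  rw [integral_finsetSum _ fun b _ => (hZ a b).const_mul _, Finset.mul_sum]
  refine Finset.sum_le_sum fun b hb => ?_
  rw [integral_const_mul]
  calc c a * c b * ∫ ω, Z a ω * Z b ω ∂μ
      ≤ |c a * c b * ∫ ω, Z a ω * Z b ω ∂μ| := le_abs_self _
    _ = |c a| * |c b| * |∫ ω, Z a ω * Z b ω ∂μ| := by rw [abs_mul, abs_mul]
    _ ≤ C * C * B a b := by
        have h0 : 0 ≤ C := (abs_nonneg _).trans (hC a ha)
        exact mul_le_mul (mul_le_mul (hC a ha) (hC b hb) (abs_nonneg _) h0) (hB a ha b hb)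
          (abs_nonneg _) (mul_nonneg h0 h0)
    _ = C ^ 2 * B a b := by ring

/-- Expand E (|f| - E|f|)² ≥ 0. -/
theorem integral_abs_le_sqrt [IsProbabilityMeasure μ] {f : Ω → ℝ}
    (hf : AEStronglyMeasurable f μ) (h2 : Integrable (fun ω => f ω ^ 2) μ) :
    Integrable f μ ∧ ∫ ω, |f ω| ∂μ ≤ √(∫ ω, f ω ^ 2 ∂μ) := by
  have hi : Integrable f μ := ((memLp_two_iff_integrable_sq hf).2 h2).integrable one_le_two
  refine ⟨hi, Real.le_sqrt_of_sq_le ?_⟩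
  set c := ∫ ω, |f ω| ∂μ with hc
  have h : 0 ≤ ∫ ω, (f ω ^ 2 - (2 * c) * |f ω| + c ^ 2) ∂μ := by
    refine integral_nonneg fun ω => ?_
    simp only [Pi.zero_apply]
    nlinarith [sq_nonneg (|f ω| - c), sq_abs (f ω)]
  have h' : Integrable (fun ω => f ω ^ 2 - (2 * c) * |f ω|) μ := h2.sub (hi.abs.const_mul _)
  rw [integral_add h' (integrable_const _), integral_sub h2 (hi.abs.const_mul _),
    integral_const_mul, ← hc] at h
  simp at h
  nlinarith

end SecondMoment

/-! ### Counting index coincidences -/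

section Counting

variable (ι : Type*) [Fintype ι] [DecidableEq ι]

theorem sum_indicator_share (m : ℝ) :
    ∑ i : ι, ∑ j : ι, ∑ k : ι, ∑ l : ι, ((if i = k then 1 else 0) + (if i = l then 1 else 0)
      + (if j = k then 1 else 0) + (if j = l then 1 else 0)) * m = 4 * Fintype.card ι ^ 3 * m := by
  simp [← Finset.sum_mul, Finset.sum_add_distrib]
  ring

/-- The power of the cardinality is the number of free indices: four for the two patterns of a
genuine 4-cycle, three for the six more degenerate ones. -/
theorem sum_indicator_offdiag (c m : ℝ) :
    ∑ i : ι, ∑ k : ι, ∑ j : ι, ∑ i' : ι, ∑ k' : ι, ∑ l : ι,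
      ((if i = i' then if k = k' then c else 0 else 0)
        + (if i = k' then if k = i' then c else 0 else 0)
        + (if i = i' then if k = k' then if j = l then m else 0 else 0 else 0)
        + (if i = k' then if k = i' then if j = l then m else 0 else 0 else 0)
        + (if i = l then if k = i' then if k' = j then m else 0 else 0 else 0)
        + (if i = l then if k = k' then if i' = j then m else 0 else 0 else 0)
        + (if k = l then if i = i' then if k' = j then m else 0 else 0 else 0)
        + (if k = l then if i = k' then if i' = j then m else 0 else 0 else 0))
      = 2 * Fintype.card ι ^ 4 * c + 6 * Fintype.card ι ^ 3 * m := by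
  simp [Finset.sum_add_distrib, Finset.sum_ite_irrel]
  ring

theorem sum_indicator_row (m : ℝ) :
    ∑ i : ι, ∑ k : ι, ∑ i' : ι, ∑ k' : ι,
      ((if i = k then if i' = k' then m else 0 else 0)
        + (if i = i' then if k = k' then m else 0 else 0)
        + (if i = k' then if k = i' then m else 0 else 0)) = 3 * Fintype.card ι ^ 2 * m := by
  simp [Finset.sum_add_distrib, Finset.sum_ite_irrel]
  ring

end Counting

/-! ### Moment bounds for sums of products of kernel values -/

namespace IsDegenerate

variable {ι E : Type*} [Fintype ι] [DecidableEq ι] [MeasurableSpace E]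
  {F : Measure E} [IsProbabilityMeasure F] {d : E → E → ℝ} (hd : IsDegenerate F d)
include hd

theorem integral_kmat_mul_four_eq_zero {a b i₂ j₂ i₃ j₃ i₄ j₄ : ι} (h₂ : i₂ ≠ a) (h₂' : j₂ ≠ a)
    (h₃ : i₃ ≠ a) (h₃' : j₃ ≠ a) (h₄ : i₄ ≠ a) (h₄' : j₄ ≠ a) :
    ∫ x, kmat d a b x * kmat d i₂ j₂ x * kmat d i₃ j₃ x * kmat d i₄ j₄ x
      ∂(Measure.pi fun _ => F) = 0 := by
  simp only [mul_assoc]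
  refine hd.integral_kmat_mul_eq_zero a b fun x z => ?_
  rw [kmat_update_of_ne d h₂ h₂', kmat_update_of_ne d h₃ h₃', kmat_update_of_ne d h₄ h₄']

theorem integrable_sq_sub_mul (i j k l : ι) :
    Integrable (fun x => (kmat d i j x ^ 2 - kernelMoment F d 2)
      * (kmat d k l x ^ 2 - kernelMoment F d 2)) (Measure.pi fun _ => F) := by
  set m := kernelMoment F d 2
  have : (fun x => (kmat d i j x ^ 2 - m) * (kmat d k l x ^ 2 - m))
      = fun x => kmat d i j x * kmat d i j x * kmat d k l x * kmat d k l x - m * kmat d i j x ^ 2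
        - m * kmat d k l x ^ 2 + m ^ 2 := by
    funext x; ring
  rw [this]
  exact (((hd.integrable_kmat_mul_four i j i j k l k l).sub
    ((hd.integrable_kmat_sq i j).const_mul _)).sub
    ((hd.integrable_kmat_sq k l).const_mul _)).add (integrable_const _)

theorem integral_sq_sub_mul {i j k l : ι} (hij : i ≠ j) (hkl : k ≠ l) :
    ∫ x, (kmat d i j x ^ 2 - kernelMoment F d 2) * (kmat d k l x ^ 2 - kernelMoment F d 2)
      ∂(Measure.pi fun _ => F)
      = ∫ x, kmat d i j x ^ 2 * kmat d k l x ^ 2 ∂(Measure.pi fun _ => F)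
        - kernelMoment F d 2 ^ 2 := by
  have e1 := hd.integral_kmat_sq hij
  have e2 := hd.integral_kmat_sq hkl
  set m := kernelMoment F d 2
  have : (fun x => (kmat d i j x ^ 2 - m) * (kmat d k l x ^ 2 - m))
      = fun x => kmat d i j x ^ 2 * kmat d k l x ^ 2 - m * kmat d i j x ^ 2
        - m * kmat d k l x ^ 2 + m ^ 2 := by
    funext x; ring
  have i0 : Integrable (fun x => kmat d i j x ^ 2 * kmat d k l x ^ 2) (Measure.pi fun _ => F) := by
    refine (hd.integrable_kmat_mul_four i j i j k l k l).congr (ae_of_all _ fun x => ?_)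
    simp only; ring
  have i1 : Integrable (fun x => kmat d i j x ^ 2 * kmat d k l x ^ 2 - m * kmat d i j x ^ 2)
    (Measure.pi fun _ => F) := i0.sub ((hd.integrable_kmat_sq i j).const_mul _)
  have i2 : Integrable (fun x => kmat d i j x ^ 2 * kmat d k l x ^ 2 - m * kmat d i j x ^ 2
    - m * kmat d k l x ^ 2) (Measure.pi fun _ => F) :=
    i1.sub ((hd.integrable_kmat_sq k l).const_mul _)
  rw [this, integral_add i2 (integrable_const _),
    integral_sub i1 ((hd.integrable_kmat_sq k l).const_mul _),
    integral_sub i0 ((hd.integrable_kmat_sq i j).const_mul _), integral_const_mul,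
    integral_const_mul, e1, e2]
  simp
  ring

/-- Disjoint pairs are independent and contribute no covariance. Otherwise at least one indicator is
1, and the covariance lies between -(E d²)² and E d⁴. -/
theorem abs_integral_sq_sub_mul_le {i j k l : ι} (hij : i ≠ j) (hkl : k ≠ l) :
    |∫ x, (kmat d i j x ^ 2 - kernelMoment F d 2) * (kmat d k l x ^ 2 - kernelMoment F d 2)
      ∂(Measure.pi fun _ => F)|
      ≤ ((if i = k then 1 else 0) + (if i = l then 1 else 0) + (if j = k then 1 else 0)
        + (if j = l then 1 else 0)) * kernelMoment F d 4 := by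
  have hm4 := hd.kernelMoment_four_nonneg
  rw [hd.integral_sq_sub_mul hij hkl]
  by_cases h : i ≠ k ∧ i ≠ l ∧ j ≠ k ∧ j ≠ l
  · obtain ⟨h1, h2, h3, h4⟩ := h
    have hind := (indepFun_eval_pair F h1 h2 h3 h4).comp (φ := fun q : E × E => d q.1 q.2 ^ 2)
      (ψ := fun q : E × E => d q.1 q.2 ^ 2) (hd.measurable.pow_const 2) (hd.measurable.pow_const 2)
    have := hind.integral_fun_mul_eq_mul_integral
      (((hd.measurable.pow_const 2).comp
        ((measurable_pi_apply i).prodMk (measurable_pi_apply j))).aestronglyMeasurable)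
      (((hd.measurable.pow_const 2).comp
        ((measurable_pi_apply k).prodMk (measurable_pi_apply l))).aestronglyMeasurable)
    have e1 := hd.integral_kmat_sq hij
    have e2 := hd.integral_kmat_sq hkl
    simp only [kmat_of_ne d hij, kmat_of_ne d hkl, Function.comp_apply] at this e1 e2 ⊢
    rw [this, e1, e2]
    simp [h1, h2, h3, h4, sq]
  · have h0 : 0 ≤ ∫ x, kmat d i j x ^ 2 * kmat d k l x ^ 2 ∂(Measure.pi fun _ => F) :=
      integral_nonneg fun x => by positivity
    have h1 : ∫ x, kmat d i j x ^ 2 * kmat d k l x ^ 2 ∂(Measure.pi fun _ => F)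
        ≤ kernelMoment F d 4 := by
      refine le_of_eq_of_le ?_ ((le_abs_self _).trans
        (hd.abs_integral_kmat_mul_four_le i j i j k l k l))
      congr 1; funext x; ring
    have h2 := hd.kernelMoment_two_sq_le
    have h3 : |∫ x, kmat d i j x ^ 2 * kmat d k l x ^ 2 ∂(Measure.pi fun _ => F)
        - kernelMoment F d 2 ^ 2| ≤ 1 * kernelMoment F d 4 := by
      rw [abs_le]; constructor <;> nlinarith [sq_nonneg (kernelMoment F d 2)]
    refine h3.trans (mul_le_mul_of_nonneg_right ?_ hm4)
    have h' : i = k ∨ i = l ∨ j = k ∨ j = l := by tauto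
    split_ifs <;> first | (norm_num; done) | (exfalso; tauto)

theorem integrable_sum_sq_sub (a : ι × ι → ℝ) (s : Finset (ι × ι)) :
    Integrable (fun x => (∑ q ∈ s, a q * (kmat d q.1 q.2 x ^ 2 - kernelMoment F d 2)) ^ 2)
      (Measure.pi fun _ => F) :=
  integrable_sum_mul_sq s a (Z := fun (q : ι × ι) x => kmat d q.1 q.2 x ^ 2 - kernelMoment F d 2)
    fun q r => hd.integrable_sq_sub_mul q.1 q.2 r.1 r.2

/-- The variance of a weighted sum of squared kernel values. -/
theorem integral_sum_sq_sub_le {a : ι × ι → ℝ} {A : ℝ} (ha : ∀ q, |a q| ≤ A) :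
    ∫ x, (∑ q : ι × ι with q.1 ≠ q.2, a q * (kmat d q.1 q.2 x ^ 2 - kernelMoment F d 2)) ^ 2
      ∂(Measure.pi fun _ => F) ≤ A ^ 2 * (4 * Fintype.card ι ^ 3 * kernelMoment F d 4) := by
  have hm4 := hd.kernelMoment_four_nonneg
  set B : ι × ι → ι × ι → ℝ := fun q r => ((if q.1 = r.1 then 1 else 0)
    + (if q.1 = r.2 then 1 else 0) + (if q.2 = r.1 then 1 else 0)
        + (if q.2 = r.2 then 1 else 0)) * kernelMoment F d 4 with hB
  have hB0 : ∀ q r, 0 ≤ B q r := fun q r => by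
    refine mul_nonneg ?_ hm4
    positivity
  refine (integral_sum_mul_sq_le (B := B) _ (fun q r => hd.integrable_sq_sub_mul q.1 q.2 r.1 r.2)
    (fun q _ => ha q) fun q hq r hr => ?_).trans ?_
  · exact hd.abs_integral_sq_sub_mul_le (Finset.mem_filter.1 hq).2 (Finset.mem_filter.1 hr).2
  · refine mul_le_mul_of_nonneg_left ?_ (sq_nonneg A)
    calc ∑ q : ι × ι with q.1 ≠ q.2, ∑ r : ι × ι with r.1 ≠ r.2, B q r
        ≤ ∑ q : ι × ι, ∑ r : ι × ι, B q r :=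
          (Finset.sum_le_sum fun q _ => Finset.sum_le_sum_of_subset_of_nonneg
            (Finset.filter_subset _ _) fun r _ _ => hB0 q r).trans
          (Finset.sum_le_sum_of_subset_of_nonneg (Finset.filter_subset _ _)
            fun q _ _ => Finset.sum_nonneg fun r _ => hB0 q r)
      _ = 4 * Fintype.card ι ^ 3 * kernelMoment F d 4 := by
          simp only [hB, Fintype.sum_prod_type]
          exact sum_indicator_share ι _

/-- Each of `i`, `k`, `i'`, `k'` must occur a second time in the product, since an index occurring
once kills the mean. The listed coincidences are the only ones compatible with `i ≠ k` and `i' ≠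
k'`. -/
theorem offdiag_cases {i k j i' k' l : ι} (hik : i ≠ k) (hik' : i' ≠ k')
    (h0 : ∫ x, (kmat d i j x * kmat d k j x) * (kmat d i' l x * kmat d k' l x)
      ∂(Measure.pi fun _ => F) ≠ 0) :
    (i ≠ j ∧ k ≠ j ∧ i' ≠ l ∧ k' ≠ l) ∧ ((i = i' ∧ k = k') ∨ (i = k' ∧ k = i') ∨
      (i = l ∧ k = i' ∧ k' = j) ∨ (i = l ∧ k = k' ∧ i' = j) ∨ (k = l ∧ i = i' ∧ k' = j)
      ∨ (k = l ∧ i = k' ∧ i' = j)) := by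
  have hij : i ≠ j := by rintro rfl; simp at h0
  have hkj : k ≠ j := by rintro rfl; simp at h0
  have hil : i' ≠ l := by rintro rfl; simp at h0
  have hkl : k' ≠ l := by rintro rfl; simp at h0
  have hi : i = i' ∨ i = k' ∨ i = l := by
    by_contra! h
    apply h0
    rw [← hd.integral_kmat_mul_four_eq_zero (a := i) (b := j) hik.symm hij.symm h.1.symm
      h.2.2.symm h.2.1.symm h.2.2.symm]
    congr 1; funext x; ring
  have hk : k = i' ∨ k = k' ∨ k = l := by
    by_contra! h
    apply h0
    rw [← hd.integral_kmat_mul_four_eq_zero (a := k) (b := j) hik hkj.symm h.1.symm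
      h.2.2.symm h.2.1.symm h.2.2.symm]
    congr 1; funext x; ring
  have hi' : i = i' ∨ k = i' ∨ i' = j := by
    by_contra! h
    apply h0
    rw [← hd.integral_kmat_mul_four_eq_zero (a := i') (b := l) h.1 h.2.2.symm h.2.1
      h.2.2.symm hik'.symm hil.symm]
    congr 1; funext x; ring
  have hk' : i = k' ∨ k = k' ∨ k' = j := by
    by_contra! h
    apply h0
    rw [← hd.integral_kmat_mul_four_eq_zero (a := k') (b := l) h.1 h.2.2.symm h.2.1
      h.2.2.symm hik' hkl.symm]
    congr 1; funext x; ring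
  clear h0
  refine ⟨⟨hij, hkj, hil, hkl⟩, ?_⟩
  grind

/-- When {i, k} = {i', k'} and `j ≠ l` the product runs around a 4-cycle and has the small mean
`kernelCycle`. Every other surviving pattern has only three free indices, so the crude bound E d⁴ is
affordable there. -/
theorem abs_integral_offdiag_le {i k j i' k' l : ι} (hik : i ≠ k) (hik' : i' ≠ k') :
    |∫ x, (kmat d i j x * kmat d k j x) * (kmat d i' l x * kmat d k' l x)
      ∂(Measure.pi fun _ => F)|
      ≤ (if i = i' then if k = k' then |kernelCycle F d| else 0 else 0)
        + (if i = k' then if k = i' then |kernelCycle F d| else 0 else 0)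
        + (if i = i' then if k = k' then if j = l then kernelMoment F d 4 else 0 else 0 else 0)
        + (if i = k' then if k = i' then if j = l then kernelMoment F d 4 else 0 else 0 else 0)
        + (if i = l then if k = i' then if k' = j then kernelMoment F d 4 else 0 else 0 else 0)
        + (if i = l then if k = k' then if i' = j then kernelMoment F d 4 else 0 else 0 else 0)
        + (if k = l then if i = i' then if k' = j then kernelMoment F d 4 else 0 else 0 else 0)
        + (if k = l then if i = k' then if i' = j then kernelMoment F d 4 else 0 else 0 else 0) := by
  have hm4 := hd.kernelMoment_four_nonneg
  have hc := abs_nonneg (kernelCycle F d)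
  have key : |∫ x, (kmat d i j x * kmat d k j x) * (kmat d i' l x * kmat d k' l x)
      ∂(Measure.pi fun _ => F)| ≤ kernelMoment F d 4 := by
    simpa only [mul_assoc] using hd.abs_integral_kmat_mul_four_le i j k j i' l k' l
  have cyc : i = i' ∧ k = k' ∨ i = k' ∧ k = i' → i ≠ j ∧ k ≠ j ∧ i' ≠ l ∧ k' ≠ l → j ≠ l →
      ∫ x, (kmat d i j x * kmat d k j x) * (kmat d i' l x * kmat d k' l x)
        ∂(Measure.pi fun _ => F) = kernelCycle F d := by
    rintro (⟨rfl, rfl⟩ | ⟨rfl, rfl⟩) ⟨h1, h2, h3, h4⟩ hjl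
    · rw [← hd.integral_kmat_cycle (ι := ι) hik h1 h2 h3 h4 hjl]
      simp only [mul_assoc]
    · rw [← hd.integral_kmat_cycle (ι := ι) hik h1 h2 h4 h3 hjl]
      congr 1; funext x; ring
  set m := kernelMoment F d 4
  set c := |kernelCycle F d|
  set I := ∫ x, (kmat d i j x * kmat d k j x) * (kmat d i' l x * kmat d k' l x)
      ∂(Measure.pi fun _ => F) with hI
  -- All eight terms are nonnegative, so it suffices to be below zero or below one of them.
  have hadd : ∀ y p₁ p₂ p₃ p₄ p₅ p₆ p₇ p₈ : ℝ, 0 ≤ p₁ → 0 ≤ p₂ → 0 ≤ p₃ → 0 ≤ p₄ → 0 ≤ p₅ →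
      0 ≤ p₆ → 0 ≤ p₇ → 0 ≤ p₈ → (y ≤ 0 ∨ y ≤ p₁ ∨ y ≤ p₂ ∨ y ≤ p₃ ∨ y ≤ p₄ ∨ y ≤ p₅ ∨ y ≤ p₆
        ∨ y ≤ p₇ ∨ y ≤ p₈) → y ≤ p₁ + p₂ + p₃ + p₄ + p₅ + p₆ + p₇ + p₈ := by
    intro y p₁ p₂ p₃ p₄ p₅ p₆ p₇ p₈ _ _ _ _ _ _ _ _ h
    rcases h with h | h | h | h | h | h | h | h | h <;> linarith
  apply hadd
  any_goals (split_ifs <;> first | exact hm4 | exact hc | exact le_rfl)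
  by_cases h0 : I = 0
  · left; rw [h0, abs_zero]
  right
  obtain ⟨hne, h⟩ := hd.offdiag_cases hik hik' h0
  rcases h with ⟨a, b⟩ | ⟨a, b⟩ | ⟨a, b, e⟩ | ⟨a, b, e⟩ | ⟨a, b, e⟩ | ⟨a, b, e⟩
  · by_cases hjl : j = l
    · iterate 2 right
      left; rwa [if_pos a, if_pos b, if_pos hjl]
    · left; rw [if_pos a, if_pos b, cyc (Or.inl ⟨a, b⟩) hne hjl]
  · by_cases hjl : j = l
    · iterate 3 right
      left; rwa [if_pos a, if_pos b, if_pos hjl]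
    · right; left; rw [if_pos a, if_pos b, cyc (Or.inr ⟨a, b⟩) hne hjl]
  · iterate 4 right
    left; rwa [if_pos a, if_pos b, if_pos e]
  · iterate 5 right
    left; rwa [if_pos a, if_pos b, if_pos e]
  · iterate 6 right
    left; rwa [if_pos a, if_pos b, if_pos e]
  · iterate 7 right
    rwa [if_pos a, if_pos b, if_pos e]

theorem integrable_kmat_mul_mul (i j k l i' j' k' l' : ι) :
    Integrable (fun x => (kmat d i j x * kmat d k l x) * (kmat d i' j' x * kmat d k' l' x))
      (Measure.pi fun _ => F) := by
  simpa only [mul_assoc] using hd.integrable_kmat_mul_four i j k l i' j' k' l'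

/-- The second moment of the off-diagonal part of a sum of squared rows. -/
theorem integral_sum_offdiag_sq_le {w : ι → ι → ℝ} {W : ℝ} (hw : ∀ i j, |w i j| ≤ W) :
    ∫ x, (∑ q : ι × ι × ι with q.1 ≠ q.2.1, (w q.1 q.2.2 * w q.2.1 q.2.2)
        * (kmat d q.1 q.2.2 x * kmat d q.2.1 q.2.2 x)) ^ 2 ∂(Measure.pi fun _ => F)
      ≤ W ^ 4 * (2 * Fintype.card ι ^ 4 * |kernelCycle F d|
        + 6 * Fintype.card ι ^ 3 * kernelMoment F d 4) := by
  have hm4 := hd.kernelMoment_four_nonneg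
  set B : ι × ι × ι → ι × ι × ι → ℝ := fun q r =>
    (if q.1 = r.1 then if q.2.1 = r.2.1 then |kernelCycle F d| else 0 else 0)
        + (if q.1 = r.2.1 then if q.2.1 = r.1 then |kernelCycle F d| else 0 else 0)
        + (if q.1 = r.1 then if q.2.1 = r.2.1 then if q.2.2 = r.2.2 then kernelMoment F d 4
            else 0 else 0 else 0)
        + (if q.1 = r.2.1 then if q.2.1 = r.1 then if q.2.2 = r.2.2 then kernelMoment F d 4
            else 0 else 0 else 0)
        + (if q.1 = r.2.2 then if q.2.1 = r.1 then if r.2.1 = q.2.2 then kernelMoment F d 4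
            else 0 else 0 else 0)
        + (if q.1 = r.2.2 then if q.2.1 = r.2.1 then if r.1 = q.2.2 then kernelMoment F d 4
            else 0 else 0 else 0)
        + (if q.2.1 = r.2.2 then if q.1 = r.1 then if r.2.1 = q.2.2 then kernelMoment F d 4
            else 0 else 0 else 0)
        + (if q.2.1 = r.2.2 then if q.1 = r.2.1 then if r.1 = q.2.2 then kernelMoment F d 4
            else 0 else 0 else 0) with hB
  have hB0 : ∀ q r, 0 ≤ B q r := fun q r => by
    simp only [hB]
    repeat' apply add_nonneg
    all_goals (split_ifs <;> first | exact hm4 | exact abs_nonneg _ | exact le_rfl)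
  have hW : ∀ q ∈ (Finset.univ : Finset (ι × ι × ι)).filter (fun q => q.1 ≠ q.2.1),
      |w q.1 q.2.2 * w q.2.1 q.2.2| ≤ W ^ 2 := fun q _ => by
    rw [abs_mul, sq]
    exact mul_le_mul (hw _ _) (hw _ _) (abs_nonneg _) ((abs_nonneg _).trans (hw q.1 q.1))
  refine (integral_sum_mul_sq_le (B := B) _ (fun q r => hd.integrable_kmat_mul_mul _ _ _ _ _ _ _ _)
    hW fun q hq r hr => ?_).trans ?_
  · exact hd.abs_integral_offdiag_le (Finset.mem_filter.1 hq).2 (Finset.mem_filter.1 hr).2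
  · rw [show (W ^ 2) ^ 2 = W ^ 4 by ring]
    refine mul_le_mul_of_nonneg_left ?_ (Even.pow_nonneg (by decide) W)
    calc ∑ q : ι × ι × ι with q.1 ≠ q.2.1, ∑ r : ι × ι × ι with r.1 ≠ r.2.1, B q r
        ≤ ∑ q : ι × ι × ι, ∑ r : ι × ι × ι, B q r :=
          (Finset.sum_le_sum fun q _ => Finset.sum_le_sum_of_subset_of_nonneg
            (Finset.filter_subset _ _) fun r _ _ => hB0 q r).trans
          (Finset.sum_le_sum_of_subset_of_nonneg (Finset.filter_subset _ _)
            fun q _ _ => Finset.sum_nonneg fun r _ => hB0 q r)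
      _ = 2 * Fintype.card ι ^ 4 * |kernelCycle F d|
          + 6 * Fintype.card ι ^ 3 * kernelMoment F d 4 := by
          simp only [hB, Fintype.sum_prod_type]
          exact sum_indicator_offdiag ι _ _

/-- All four factors share the point `j`, so a nonzero mean forces `i`, `k`, `i'`, `k'` to match in
pairs, in one of three ways. -/
theorem abs_integral_row_le (i k i' k' j : ι) :
    |∫ x, (kmat d i j x * kmat d k j x) * (kmat d i' j x * kmat d k' j x)
      ∂(Measure.pi fun _ => F)|
      ≤ (if i = k then if i' = k' then kernelMoment F d 4 else 0 else 0)
        + (if i = i' then if k = k' then kernelMoment F d 4 else 0 else 0)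
        + (if i = k' then if k = i' then kernelMoment F d 4 else 0 else 0) := by
  have hm4 := hd.kernelMoment_four_nonneg
  have key : |∫ x, (kmat d i j x * kmat d k j x) * (kmat d i' j x * kmat d k' j x)
      ∂(Measure.pi fun _ => F)| ≤ kernelMoment F d 4 := by
    simpa only [mul_assoc] using hd.abs_integral_kmat_mul_four_le i j k j i' j k' j
  by_cases h : (i = k ∧ i' = k') ∨ (i = i' ∧ k = k') ∨ (i = k' ∧ k = i')
  · refine key.trans ?_
    set m := kernelMoment F d 4
    have : ∀ p q r : ℝ, 0 ≤ p → 0 ≤ q → 0 ≤ r → (p = m ∨ q = m ∨ r = m) → m ≤ p + q + r := by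
      intro p q r _ _ _ h
      rcases h with h | h | h <;> linarith
    apply this
    any_goals positivity
    rcases h with ⟨a, b⟩ | ⟨a, b⟩ | ⟨a, b⟩
    · exact Or.inl (by rw [if_pos a, if_pos b])
    · exact Or.inr (Or.inl (by rw [if_pos a, if_pos b]))
    · exact Or.inr (Or.inr (by rw [if_pos a, if_pos b]))
  have h0 : ∫ x, (kmat d i j x * kmat d k j x) * (kmat d i' j x * kmat d k' j x)
      ∂(Measure.pi fun _ => F) = 0 := by
    by_cases hij : i = j
    · simp [hij]
    by_cases hkj : k = j
    · simp [hkj]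
    by_cases hij' : i' = j
    · simp [hij']
    by_cases hkj' : k' = j
    · simp [hkj']
    have hcase : (k ≠ i ∧ i' ≠ i ∧ k' ≠ i) ∨ (i ≠ k ∧ i' ≠ k ∧ k' ≠ k)
        ∨ (i ≠ i' ∧ k ≠ i' ∧ k' ≠ i') ∨ (i ≠ k' ∧ k ≠ k' ∧ i' ≠ k') := by clear key; grind
    rcases hcase with ⟨a, b, c⟩ | ⟨a, b, c⟩ | ⟨a, b, c⟩ | ⟨a, b, c⟩
    · rw [← hd.integral_kmat_mul_four_eq_zero (a := i) (b := j) (i₂ := k) (j₂ := j) (i₃ := i')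
        (j₃ := j) (i₄ := k') (j₄ := j) a (Ne.symm hij) b (Ne.symm hij) c (Ne.symm hij)]
      congr 1; funext x; ring
    · rw [← hd.integral_kmat_mul_four_eq_zero (a := k) (b := j) (i₂ := i) (j₂ := j) (i₃ := i')
        (j₃ := j) (i₄ := k') (j₄ := j) a (Ne.symm hkj) b (Ne.symm hkj) c (Ne.symm hkj)]
      congr 1; funext x; ring
    · rw [← hd.integral_kmat_mul_four_eq_zero (a := i') (b := j) (i₂ := i) (j₂ := j) (i₃ := k)
        (j₃ := j) (i₄ := k') (j₄ := j) a (Ne.symm hij') b (Ne.symm hij') c (Ne.symm hij')]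
      congr 1; funext x; ring
    · rw [← hd.integral_kmat_mul_four_eq_zero (a := k') (b := j) (i₂ := i) (j₂ := j) (i₃ := k)
        (j₃ := j) (i₄ := i') (j₄ := j) a (Ne.symm hkj') b (Ne.symm hkj') c (Ne.symm hkj')]
      congr 1; funext x; ring
  rw [h0, abs_zero]; positivity

omit hd [MeasurableSpace E] [IsProbabilityMeasure F] in
theorem row_sq_eq (w : ι → ι → ℝ) (j : ι) (x : ι → E) :
    (∑ i, w i j * kmat d i j x) ^ 2
      = ∑ q : ι × ι, (w q.1 j * w q.2 j) * (kmat d q.1 j x * kmat d q.2 j x) := by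
  rw [sq, Finset.sum_mul_sum, Fintype.sum_prod_type]
  exact Finset.sum_congr rfl fun a _ => Finset.sum_congr rfl fun b _ => by ring

theorem integrable_row_pow_four (w : ι → ι → ℝ) (j : ι) :
    Integrable (fun x => (∑ i, w i j * kmat d i j x) ^ 4) (Measure.pi fun _ => F) := by
  have e : (fun x : ι → E => (∑ i, w i j * kmat d i j x) ^ 4)
      = fun x => (∑ q : ι × ι, (w q.1 j * w q.2 j) * (kmat d q.1 j x * kmat d q.2 j x)) ^ 2 := by
    funext x; rw [← row_sq_eq w j x]; ring
  rw [e]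
  exact integrable_sum_mul_sq Finset.univ (fun q : ι × ι => w q.1 j * w q.2 j)
    (Z := fun (q : ι × ι) x => kmat d q.1 j x * kmat d q.2 j x)
    fun q r => hd.integrable_kmat_mul_mul q.1 j q.2 j r.1 j r.2 j

/-- The fourth power of a row is the square of a double sum, so the second-moment bound applies.
Only the three pairings survive, each with two free indices. -/
theorem integral_row_pow_four_le {w : ι → ι → ℝ} {W : ℝ} (hw : ∀ i j, |w i j| ≤ W) (j : ι) :
    ∫ x, (∑ i, w i j * kmat d i j x) ^ 4 ∂(Measure.pi fun _ => F)
      ≤ W ^ 4 * (3 * Fintype.card ι ^ 2 * kernelMoment F d 4) := by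
  have e : (fun x : ι → E => (∑ i, w i j * kmat d i j x) ^ 4)
      = fun x => (∑ q : ι × ι, (w q.1 j * w q.2 j) * (kmat d q.1 j x * kmat d q.2 j x)) ^ 2 := by
    funext x; rw [← row_sq_eq w j x]; ring
  have hW : ∀ q ∈ (Finset.univ : Finset (ι × ι)), |w q.1 j * w q.2 j| ≤ W ^ 2 := fun q _ => by
    rw [abs_mul, sq]
    exact mul_le_mul (hw _ _) (hw _ _) (abs_nonneg _) ((abs_nonneg _).trans (hw q.1 q.1))
  rw [e]
  refine (integral_sum_mul_sq_le (Finset.univ : Finset (ι × ι))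
    (Z := fun (q : ι × ι) x => kmat d q.1 j x * kmat d q.2 j x) (fun q r => hd.integrable_kmat_mul_mul q.1 j q.2 j r.1 j r.2 j) hW
    fun q _ r _ => hd.abs_integral_row_le q.1 q.2 r.1 r.2 j).trans_eq ?_
  rw [show (W ^ 2) ^ 2 = W ^ 4 by ring, ← sum_indicator_row ι]
  simp only [Fintype.sum_prod_type]

end IsDegenerate

/-! ### From an approximate differential equation to a Gaussian characteristic function -/

theorem norm_exp_I_mul_sub_one_sub_le (s : ℝ) :
    ‖Complex.exp (Complex.I * s) - 1 - Complex.I * s‖ ≤ s ^ 2 := by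
  have hder : ∀ x : ℝ, HasDerivAt (fun y : ℝ => Complex.exp (Complex.I * y) - 1 - Complex.I * y)
      (Complex.I * (Complex.exp (Complex.I * x) - 1)) x := fun x => by
    have h1 : HasDerivAt (fun y : ℝ => Complex.I * (y : ℂ)) Complex.I x := by
      simpa using (Complex.ofRealCLM.hasDerivAt (x := x)).const_mul Complex.I
    refine ((h1.cexp.sub_const 1).sub h1).congr_deriv ?_
    ring
  -- Mean value inequality: the derivative i(exp(ix) - 1) has norm at most |x| ≤ |s| on this
  -- interval. The lost factor ½ is immaterial.
  have := (convex_Icc (-|s|) |s|).norm_image_sub_le_of_norm_hasDerivWithin_le (C := |s|) (x := 0)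
    (y := s) (fun x _ => (hder x).hasDerivWithinAt) (fun x hx => ?_)
    ⟨by simp, abs_nonneg s⟩ ⟨neg_abs_le s, le_abs_self s⟩
  · simpa [← sq] using this
  · rw [norm_mul, Complex.norm_I, one_mul]
    exact Real.norm_exp_I_mul_ofReal_sub_one_le.trans (abs_le.2 hx)

theorem norm_exp_I_mul_mul (a b : ℝ) : ‖Complex.exp (Complex.I * (a * b))‖ = 1 := by
  rw [mul_comm, ← Complex.ofReal_mul, Complex.norm_exp_ofReal_mul_I]

/-- A function that almost solves the equation of the standard Gaussian characteristic function
is close to it. -/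
theorem norm_sub_gaussian_le {ψ ψ' : ℝ → ℂ} (hψ : ∀ t, HasDerivAt ψ (ψ' t) t) (h0 : ψ 0 = 1)
    {a b : ℝ} (ha : 0 ≤ a) (hb : 0 ≤ b)
    (h : ∀ t, ‖ψ' t + t * ψ t‖ ≤ |t| * a + t ^ 2 * b) (t : ℝ) :
    ‖ψ t - Complex.exp (-(t : ℂ) ^ 2 / 2)‖ ≤ |t| * (|t| * a + t ^ 2 * b) := by
  have hE : ∀ x : ℝ, HasDerivAt (fun y : ℝ => Complex.exp ((y : ℂ) ^ 2 / 2))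
      (Complex.exp ((x : ℂ) ^ 2 / 2) * x) x := fun x => by
    have h1 : HasDerivAt (fun y : ℝ => (y : ℂ)) 1 x := Complex.ofRealCLM.hasDerivAt
    refine ((h1.pow 2).div_const 2).cexp.congr_deriv ?_
    simp
  have hnE : ∀ x : ℝ, ‖Complex.exp ((x : ℂ) ^ 2 / 2)‖ = Real.exp (x ^ 2 / 2) := fun x => by
    rw [Complex.norm_exp]; norm_cast
  have hder : ∀ x : ℝ, HasDerivAt (fun y : ℝ => ψ y * Complex.exp ((y : ℂ) ^ 2 / 2))
      ((ψ' x + x * ψ x) * Complex.exp ((x : ℂ) ^ 2 / 2)) x := fun x =>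
    ((hψ x).mul (hE x)).congr_deriv (by ring)
  -- The integrating factor exp(x²/2) makes the derivative small. Its largest value exp(t²/2) on the
  -- interval cancels when the factor is divided out at `t`.
  have key := (convex_Icc (-|t|) |t|).norm_image_sub_le_of_norm_hasDerivWithin_le
    (C := (|t| * a + t ^ 2 * b) * Real.exp (t ^ 2 / 2)) (x := 0)
    (y := t) (fun x _ => (hder x).hasDerivWithinAt) (fun x hx => ?_)
    ⟨by simp, abs_nonneg t⟩ ⟨neg_abs_le t, le_abs_self t⟩
  · have e : ψ t - Complex.exp (-(t : ℂ) ^ 2 / 2) = (ψ t * Complex.exp ((t : ℂ) ^ 2 / 2) -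
        ψ 0 * Complex.exp (((0 : ℝ) : ℂ) ^ 2 / 2)) * Complex.exp (-(t : ℂ) ^ 2 / 2) := by
      rw [sub_mul, mul_assoc, ← Complex.exp_add, h0]
      have : (t : ℂ) ^ 2 / 2 + -(t : ℂ) ^ 2 / 2 = 0 := by ring
      rw [this]; simp
    have hn : ‖Complex.exp (-(t : ℂ) ^ 2 / 2)‖ = Real.exp (-t ^ 2 / 2) := by
      rw [Complex.norm_exp]; norm_cast
    rw [e, norm_mul, hn]
    calc _ ≤ (|t| * a + t ^ 2 * b) * Real.exp (t ^ 2 / 2) * ‖t - 0‖ * Real.exp (-t ^ 2 / 2) :=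
          mul_le_mul_of_nonneg_right key (Real.exp_nonneg _)
      _ = |t| * (|t| * a + t ^ 2 * b) * (Real.exp (t ^ 2 / 2) * Real.exp (-t ^ 2 / 2)) := by
          rw [sub_zero, Real.norm_eq_abs]; ring
      _ = |t| * (|t| * a + t ^ 2 * b) := by
          rw [← Real.exp_add]
          have : t ^ 2 / 2 + -t ^ 2 / 2 = 0 := by ring
          rw [this, Real.exp_zero, mul_one]
  · have hx' : |x| ≤ |t| := abs_le.2 hx
    have hx2 : x ^ 2 ≤ t ^ 2 := sq_le_sq.2 hx'
    rw [norm_mul, hnE]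
    refine mul_le_mul ((h x).trans ?_) (Real.exp_le_exp.2 (by linarith)) (Real.exp_nonneg _)
      (by positivity)
    gcongr

/-! ### Stein's method for a degenerate quadratic statistic -/

section Row

variable {ι E : Type*} [Fintype ι] [DecidableEq ι]

/-- The part of a weighted sum of kernel values that involves the `j`-th sample point. -/
noncomputable def row (w : ι → ι → ℝ) (d : E → E → ℝ) (j : ι) (x : ι → E) : ℝ :=
  ∑ i, w i j * kmat d i j x

/-- The weighted sum of kernel values over unordered pairs of sample points. -/
noncomputable def stat (w : ι → ι → ℝ) (d : E → E → ℝ) (x : ι → E) : ℝ :=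
  1 / 2 * ∑ j, row w d j x

/-- The part of a weighted sum of kernel values that does not involve the `j`-th point. -/
noncomputable def rest (w : ι → ι → ℝ) (d : E → E → ℝ) (j : ι) (x : ι → E) : ℝ :=
  1 / 2 * ∑ k ∈ Finset.univ.erase j, ∑ i ∈ Finset.univ.erase j, w i k * kmat d i k x

theorem rest_update (w : ι → ι → ℝ) (d : E → E → ℝ) (j : ι) (x : ι → E) (z : E) :
    rest w d j (Function.update x j z) = rest w d j x := by
  unfold rest
  congr 1
  refine Finset.sum_congr rfl fun k hk => Finset.sum_congr rfl fun i hi => ?_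
  rw [kmat_update_of_ne d (Finset.ne_of_mem_erase hi) (Finset.ne_of_mem_erase hk)]

variable [MeasurableSpace E] {F : Measure E} {d : E → E → ℝ} (hd : IsDegenerate F d)
  {w : ι → ι → ℝ} (hw : ∀ i j, w i j = w j i)

namespace IsDegenerate

include hd

-- The full double sum meets the pairs containing `j` once as a column and once as a row. Symmetry
-- makes the two parts equal, which absorbs the factor ½.
include hw in
theorem stat_eq_row_add_rest (j : ι) (x : ι → E) : stat w d x = row w d j x + rest w d j x := by
  unfold stat rest row
  have h1 : ∀ k, ∑ i, w i k * kmat d i k x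
      = w j k * kmat d j k x + ∑ i ∈ Finset.univ.erase j, w i k * kmat d i k x := fun k =>
    (Finset.add_sum_erase _ _ (Finset.mem_univ j)).symm
  rw [← Finset.add_sum_erase _ _ (Finset.mem_univ j)]
  simp_rw [h1]
  rw [Finset.sum_add_distrib]
  have h2 : ∑ k ∈ Finset.univ.erase j, w j k * kmat d j k x
      = ∑ i ∈ Finset.univ.erase j, w i j * kmat d i j x :=
    Finset.sum_congr rfl fun k _ => by rw [hw j k, hd.kmat_symm j k]
  rw [h2, kmat_self]
  ring

theorem measurable_row (w : ι → ι → ℝ) (j : ι) : Measurable (row w d j) := by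
  unfold row
  exact Finset.measurable_sum _ fun i _ => (hd.measurable_kmat i j).const_mul _

theorem measurable_stat (w : ι → ι → ℝ) : Measurable (stat w d : (ι → E) → ℝ) := by
  unfold stat
  exact (Finset.measurable_sum _ fun j _ => hd.measurable_row w j).const_mul _

theorem measurable_rest (w : ι → ι → ℝ) (j : ι) : Measurable (rest w d j) := by
  unfold rest
  exact (Finset.measurable_sum _ fun k _ => Finset.measurable_sum _ fun i _ =>
    (hd.measurable_kmat i k).const_mul _).const_mul _

variable [IsProbabilityMeasure F]

theorem memLp_row (w : ι → ι → ℝ) (j : ι) : MemLp (row w d j) 2 (Measure.pi fun _ => F) := by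
  unfold row
  exact memLp_finsetSum _ fun i _ => (hd.memLp_kmat i j).const_mul _

theorem memLp_stat (w : ι → ι → ℝ) :
    MemLp (stat w d : (ι → E) → ℝ) 2 (Measure.pi fun _ => F) := by
  unfold stat
  exact (memLp_finsetSum _ fun j _ => hd.memLp_row w j).const_mul _

theorem memLp_rest (w : ι → ι → ℝ) (j : ι) : MemLp (rest w d j) 2 (Measure.pi fun _ => F) := by
  unfold rest
  exact (memLp_finsetSum _ fun k _ => memLp_finsetSum _ fun i _ =>
    (hd.memLp_kmat i k).const_mul _).const_mul _

theorem integrable_row_sq (w : ι → ι → ℝ) (j : ι) :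
    Integrable (fun x => row w d j x ^ 2) (Measure.pi fun _ => F) :=
  (hd.memLp_row w j).integrable_sq

/-- A row is uncorrelated with every function of the other sample points. -/
theorem integral_row_smul_eq_zero {G : Type*} [NormedAddCommGroup G] [NormedSpace ℝ G]
    [CompleteSpace G] (w : ι → ι → ℝ) (j : ι) {g : (ι → E) → G}
    (hg : ∀ x z, g (Function.update x j z) = g x)
    (hi : ∀ i, Integrable (fun x => kmat d i j x • g x) (Measure.pi fun _ => F)) :
    ∫ x, row w d j x • g x ∂(Measure.pi fun _ => F) = 0 := by
  simp only [row, Finset.sum_smul, mul_smul]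
  rw [integral_finsetSum _ fun i _ => (hi i).fun_smul (w i j)]
  refine Finset.sum_eq_zero fun i _ => ?_
  rw [integral_smul]
  simp only [hd.kmat_symm i j]
  rw [hd.integral_kmat_smul_eq_zero j i hg, smul_zero]

omit [DecidableEq ι] hd [IsProbabilityMeasure F] in
theorem integrable_smul_bounded {f : (ι → E) → ℝ} (hf : Integrable f (Measure.pi fun _ => F))
    {g : (ι → E) → ℝ} (hg : Measurable g) (t : ℝ) :
    Integrable (fun x => f x • Complex.exp (Complex.I * (t * g x))) (Measure.pi fun _ => F) := by
  refine hf.norm.mono' (hf.1.smul (by fun_prop)) (ae_of_all _ fun x => ?_)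
  rw [norm_smul, norm_exp_I_mul_mul, mul_one]

-- Write T² = ½ Σ R_j T with T = R_j + `rest`; the second part is uncorrelated with R_j.
include hw in
theorem integral_stat_sq :
    ∫ x, stat w d x ^ 2 ∂(Measure.pi fun _ => F)
      = 1 / 2 * ∫ x, ∑ j, row w d j x ^ 2 ∂(Measure.pi fun _ => F) := by
  have h1 : ∀ x : ι → E, stat w d x ^ 2
      = 1 / 2 * ∑ j, (row w d j x ^ 2 + row w d j x • rest w d j x) := fun x => by
    rw [sq]
    nth_rewrite 1 [stat]
    rw [mul_assoc, Finset.sum_mul]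
    congr 1
    refine Finset.sum_congr rfl fun j _ => ?_
    rw [hd.stat_eq_row_add_rest hw j x, smul_eq_mul]; ring
  have h2 : ∀ j, Integrable (fun x => row w d j x • rest w d j x) (Measure.pi fun _ => F) :=
    fun j => (hd.memLp_row w j).integrable_mul (hd.memLp_rest w j)
  have h12 : ∀ j, Integrable (fun x => row w d j x ^ 2 + row w d j x • rest w d j x)
    (Measure.pi fun _ => F) := fun j => (hd.integrable_row_sq w j).add (h2 j)
  simp only [h1]
  rw [integral_const_mul, integral_finsetSum _ fun j _ => h12 j,
    integral_finsetSum _ fun j _ => hd.integrable_row_sq w j]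
  congr 1
  refine Finset.sum_congr rfl fun j _ => ?_
  rw [integral_add (hd.integrable_row_sq w j) (h2 j),
    hd.integral_row_smul_eq_zero w j (rest_update w d j) fun i =>
      (hd.memLp_kmat i j).integrable_mul (hd.memLp_rest w j), add_zero]

/-- Differentiation under the integral sign, dominated by |T|, which is integrable because T is in
L². -/
theorem hasDerivAt_charFun_stat (w : ι → ι → ℝ) (t : ℝ) :
    HasDerivAt (fun s : ℝ => ∫ x : ι → E, Complex.exp (Complex.I * (s * stat w d x))
        ∂(Measure.pi fun _ => F))
      (∫ x : ι → E, stat w d x • (Complex.I * Complex.exp (Complex.I * (t * stat w d x)))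
        ∂(Measure.pi fun _ => F)) t := by
  have hm := hd.measurable_stat w
  refine (hasDerivAt_integral_of_dominated_loc_of_deriv_le (s := Set.univ)
    (F := fun (s : ℝ) (x : ι → E) => Complex.exp (Complex.I * (s * stat w d x)))
    (F' := fun (s : ℝ) (x : ι → E) =>
      stat w d x • (Complex.I * Complex.exp (Complex.I * (s * stat w d x))))
    (bound := fun x => |stat w d x|) Filter.univ_mem
    (Eventually.of_forall fun s => ?_) ?_ ?_ (ae_of_all _ fun x s _ => ?_)
    ((hd.memLp_stat w).integrable one_le_two).abs (ae_of_all _ fun x s _ => ?_)).2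
  · exact Measurable.aestronglyMeasurable (by fun_prop)
  · refine (integrable_const (1 : ℝ)).mono' (Measurable.aestronglyMeasurable (by fun_prop))
      (ae_of_all _ fun x => (norm_exp_I_mul_mul _ _).le)
  · exact Measurable.aestronglyMeasurable (by fun_prop)
  · rw [norm_smul, norm_mul, norm_exp_I_mul_mul, Complex.norm_I]; simp
  · have h1 : HasDerivAt (fun y : ℝ => Complex.I * ((y : ℂ) * (stat w d x : ℂ)))
        (Complex.I * (stat w d x : ℂ)) s := by
      simpa using ((Complex.ofRealCLM.hasDerivAt (x := s)).mul_const
        (stat w d x : ℂ)).const_mul Complex.I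
    refine h1.cexp.congr_deriv ?_
    rw [Complex.real_smul]; ring

/-- Stein's identity for a degenerate quadratic statistic, with its error. -/
theorem norm_deriv_add_mul_le (hw : ∀ i j, w i j = w j i) (t : ℝ)
    (h3 : ∀ j, Integrable (fun x => |row w d j x| ^ 3) (Measure.pi fun _ => F)) :
    ‖(∫ x : ι → E, stat w d x • (Complex.I * Complex.exp (Complex.I * (t * stat w d x)))
        ∂(Measure.pi fun _ => F))
      + t * ∫ x : ι → E, Complex.exp (Complex.I * (t * stat w d x)) ∂(Measure.pi fun _ => F)‖
      ≤ |t| * (1 / 2 * ∫ x, |∑ j, row w d j x ^ 2 - 2| ∂(Measure.pi fun _ => F))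
        + t ^ 2 * (1 / 2 * ∑ j, ∫ x, |row w d j x| ^ 3 ∂(Measure.pi fun _ => F)) := by
  have hm := hd.measurable_stat w
  have hS := (hd.memLp_stat w).integrable one_le_two
  have hR := fun j => (hd.memLp_row w j).integrable one_le_two
  have hQ : Integrable (fun x => |∑ j, row w d j x ^ 2 - 2|) (Measure.pi fun _ => F) :=
    ((integrable_finsetSum _ fun j _ => hd.integrable_row_sq w j).sub (integrable_const _)).abs
  have i1 : Integrable (fun x : ι → E => stat w d x •
      (Complex.I * Complex.exp (Complex.I * (t * stat w d x)))) (Measure.pi fun _ => F) := by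
    refine ((integrable_smul_bounded hS hm t).const_mul Complex.I).congr
      (ae_of_all _ fun x => ?_)
    simp only [Complex.real_smul]; ring
  have i2 : Integrable (fun x : ι → E => (t : ℂ) * Complex.exp (Complex.I * (t * stat w d x)))
      (Measure.pi fun _ => F) := by
    refine Integrable.const_mul ?_ _
    refine (integrable_const (1 : ℝ)).mono' (Measurable.aestronglyMeasurable (by fun_prop))
      (ae_of_all _ fun x => (norm_exp_I_mul_mul _ _).le)
  have i3 : ∀ j, Integrable (fun x : ι → E => row w d j x •
      Complex.exp (Complex.I * (t * rest w d j x))) (Measure.pi fun _ => F) := fun j =>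
    integrable_smul_bounded (hR j) (hd.measurable_rest w j) t
  -- The leave-one-out exponentials contribute nothing, so they may be subtracted from the integrand
  -- for free.
  have e0 : ∫ x : ι → E, (Complex.I / 2) * ∑ j, row w d j x •
      Complex.exp (Complex.I * (t * rest w d j x)) ∂(Measure.pi fun _ => F) = 0 := by
    rw [integral_const_mul, integral_finsetSum _ fun j _ => i3 j, Finset.sum_eq_zero, mul_zero]
    intro j _
    refine hd.integral_row_smul_eq_zero w j (fun x z => by simp only [rest_update]) fun i => ?_
    exact integrable_smul_bounded ((hd.memLp_kmat i j).integrable one_le_two)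
      (hd.measurable_rest w j) t
  have i12 : Integrable (fun x : ι → E => stat w d x •
      (Complex.I * Complex.exp (Complex.I * (t * stat w d x)))
      + t * Complex.exp (Complex.I * (t * stat w d x))) (Measure.pi fun _ => F) := i1.add i2
  rw [← integral_const_mul, ← integral_add i1 i2, ← sub_zero (∫ x, _ ∂(Measure.pi fun _ => F)),
    ← e0, ← integral_sub i12 ((integrable_finsetSum _ fun j _ => i3 j).const_mul _)]
  have hb : Integrable (fun x => |t| * (1 / 2 * |∑ j, row w d j x ^ 2 - 2|)
      + t ^ 2 * (1 / 2 * ∑ j, |row w d j x| ^ 3)) (Measure.pi fun _ => F) :=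
    ((hQ.const_mul _).const_mul _).add
      (((integrable_finsetSum _ fun j _ => h3 j).const_mul _).const_mul _)
  refine (norm_integral_le_of_norm_le hb (ae_of_all _ fun x => ?_)).trans_eq ?_
  · set e := Complex.exp (Complex.I * (t * stat w d x)) with he
    -- First-order expansion of exp(-itR_j) in exp(it(T - R_j)) = exp(itT) exp(-itR_j). The linear
    -- term yields R_j² and the remainder a cubic error.
    have hr : ∀ j, row w d j x • e - row w d j x • Complex.exp (Complex.I * (t * rest w d j x))
        = Complex.I * t * row w d j x ^ 2 * e - row w d j x * e *
          (Complex.exp (Complex.I * ((-(t * row w d j x) : ℝ) : ℂ)) - 1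
            - Complex.I * ((-(t * row w d j x) : ℝ) : ℂ)) := fun j => by
      have : Complex.exp (Complex.I * (t * rest w d j x))
          = e * Complex.exp (Complex.I * ((-(t * row w d j x) : ℝ) : ℂ)) := by
        rw [he, ← Complex.exp_add, hd.stat_eq_row_add_rest hw j x]
        congr 1; push_cast; ring
      rw [this, Complex.real_smul, Complex.real_smul]
      push_cast; ring
    have hst : (stat w d x : ℂ) = 1 / 2 * ∑ j, (row w d j x : ℂ) := by
      rw [stat]; push_cast; ring
    -- Summed over j, the linear terms give -(t/2) Σ R_j², which nearly cancels the added `t * e`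
    -- because Σ R_j² is close to 2.
    have hmain : stat w d x • (Complex.I * e) + t * e - Complex.I / 2 * ∑ j, row w d j x •
          Complex.exp (Complex.I * (t * rest w d j x))
        = -(t / 2) * ((∑ j, row w d j x ^ 2 - 2 : ℝ) : ℂ) * e - Complex.I / 2 * ∑ j,
          row w d j x * e * (Complex.exp (Complex.I * ((-(t * row w d j x) : ℝ) : ℂ)) - 1
            - Complex.I * ((-(t * row w d j x) : ℝ) : ℂ)) := by
      have h1 : stat w d x • (Complex.I * e) = Complex.I / 2 * ∑ j, row w d j x • e := by
        rw [Complex.real_smul, hst, ← Finset.sum_smul, Complex.real_smul]; push_cast; ring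
      have h2 : ∑ j, row w d j x • e = ∑ j, row w d j x •
          Complex.exp (Complex.I * (t * rest w d j x)) + (∑ j, Complex.I * t * row w d j x ^ 2 * e
          - ∑ j, row w d j x * e * (Complex.exp (Complex.I * ((-(t * row w d j x) : ℝ) : ℂ)) - 1
            - Complex.I * ((-(t * row w d j x) : ℝ) : ℂ))) := by
        rw [← Finset.sum_sub_distrib, ← Finset.sum_add_distrib]
        refine Finset.sum_congr rfl fun j _ => ?_
        rw [← hr j]; ring
      have h3 : ∑ j, Complex.I * t * row w d j x ^ 2 * e
          = Complex.I * t * ((∑ j, row w d j x ^ 2 : ℝ) : ℂ) * e := by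
        push_cast; rw [Finset.mul_sum, Finset.sum_mul]
      rw [h1, h2, h3]
      push_cast
      linear_combination (t / 2 * (∑ j, (row w d j x : ℂ) ^ 2) * e) * Complex.I_sq
    have hne : ‖e‖ = 1 := norm_exp_I_mul_mul _ _
    rw [hmain]
    refine (norm_sub_le _ _).trans (add_le_add (le_of_eq ?_) ?_)
    · rw [norm_mul, norm_mul, hne, Complex.norm_real, norm_neg, norm_div, Complex.norm_real]
      simp; ring
    · rw [norm_mul, norm_div, Complex.norm_I, Complex.norm_ofNat]
      rw [← mul_assoc, mul_comm (t ^ 2), mul_assoc, Finset.mul_sum]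
      refine mul_le_mul_of_nonneg_left ((norm_sum_le _ _).trans
        (Finset.sum_le_sum fun j _ => ?_)) (by norm_num)
      rw [norm_mul, norm_mul, hne, Complex.norm_real, Real.norm_eq_abs, mul_one]
      refine (mul_le_mul_of_nonneg_left (norm_exp_I_mul_sub_one_sub_le _)
        (abs_nonneg _)).trans_eq ?_
      rw [neg_sq, mul_pow, ← sq_abs (row w d j x)]; ring
  · rw [integral_add ((hQ.const_mul _).const_mul _)
      (((integrable_finsetSum _ fun j _ => h3 j).const_mul _).const_mul _), integral_const_mul,
      integral_const_mul, integral_const_mul, integral_const_mul,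
      integral_finsetSum _ fun j _ => h3 j]

/-- Integrate u²(u - δ)² ≥ 0. The free parameter δ later balances the second moment against the
fourth. -/
theorem integral_abs_row_pow_three (w : ι → ι → ℝ) (j : ι) {δ : ℝ} (hδ : 0 < δ) :
    Integrable (fun x => |row w d j x| ^ 3) (Measure.pi fun _ => F) ∧
    ∫ x, |row w d j x| ^ 3 ∂(Measure.pi fun _ => F)
      ≤ (δ * ∫ x, row w d j x ^ 2 ∂(Measure.pi fun _ => F)
        + (∫ x, row w d j x ^ 4 ∂(Measure.pi fun _ => F)) / δ) / 2 := by
  have h2 := hd.integrable_row_sq w j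
  have h4 : Integrable (fun x => row w d j x ^ 4) (Measure.pi fun _ => F) :=
    hd.integrable_row_pow_four w j
  have hp : ∀ r : ℝ, |r| ^ 3 ≤ (δ * r ^ 2 + r ^ 4 / δ) / 2 := fun r => by
    rw [← sq_abs r, ← Even.pow_abs (by decide : Even 4) r]
    generalize |r| = u
    rw [← sub_nonneg]
    have : (δ * u ^ 2 + u ^ 4 / δ) / 2 - u ^ 3 = u ^ 2 * (u - δ) ^ 2 / (2 * δ) := by
      field_simp; ring
    rw [this]; positivity
  have hb : Integrable (fun x => (δ * row w d j x ^ 2 + row w d j x ^ 4 / δ) / 2)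
    (Measure.pi fun _ => F) := ((h2.const_mul _).add (h4.div_const _)).div_const _
  have hi : Integrable (fun x => |row w d j x| ^ 3) (Measure.pi fun _ => F) := by
    refine hb.mono' ((hd.measurable_row w j).abs.pow_const 3).aestronglyMeasurable
      (ae_of_all _ fun x => ?_)
    rw [Real.norm_eq_abs, abs_pow, abs_abs]
    exact hp _
  refine ⟨hi, (integral_mono hi hb fun x => hp _).trans_eq ?_⟩
  rw [integral_div, integral_add (h2.const_mul _) (h4.div_const _), integral_const_mul,
    integral_div]

/-- The mean absolute deviation of the sum of squared rows from its mean. -/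
theorem integral_abs_sum_row_sq_sub_le {W : ℝ} (hW : ∀ i j, |w i j| ≤ W)
    (hnorm : (∑ q : ι × ι with q.1 ≠ q.2, w q.1 q.2 ^ 2) * kernelMoment F d 2 = 2) :
    ∫ x, |∑ j, row w d j x ^ 2 - 2| ∂(Measure.pi fun _ => F)
      ≤ √(W ^ 4 * (20 * Fintype.card ι ^ 3 * kernelMoment F d 4
        + 4 * Fintype.card ι ^ 4 * |kernelCycle F d|)) := by
  set f : (ι → E) → ℝ := fun x =>
    ∑ q : ι × ι with q.1 ≠ q.2, w q.1 q.2 ^ 2 * (kmat d q.1 q.2 x ^ 2 - kernelMoment F d 2) with hf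
  set g : (ι → E) → ℝ := fun x =>
    ∑ q : ι × ι × ι with q.1 ≠ q.2.1, (w q.1 q.2.2 * w q.2.1 q.2.2)
        * (kmat d q.1 q.2.2 x * kmat d q.2.1 q.2.2 x) with hg
  -- Diagonal terms of the squared rows, centered by means adding up to 2, form `f`; the mixed
  -- products form `g`.
  have hsum : ∀ x, ∑ j, row w d j x ^ 2 - 2 = f x + g x := fun x => by
    have h1 : f x = ∑ q : ι × ι, w q.1 q.2 ^ 2 * kmat d q.1 q.2 x ^ 2 - 2 := by
      rw [hf, ← hnorm]
      simp only [mul_sub]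
      rw [Finset.sum_sub_distrib, Finset.sum_mul]
      congr 1
      rw [Finset.sum_filter]
      refine Finset.sum_congr rfl fun q _ => ?_
      split_ifs with h
      · rfl
      · rw [not_not] at h; rw [h, kmat_self]; simp
    have h2 : ∑ j, row w d j x ^ 2 = ∑ q : ι × ι × ι, (w q.1 q.2.2 * w q.2.1 q.2.2)
        * (kmat d q.1 q.2.2 x * kmat d q.2.1 q.2.2 x) := by
      simp only [row, row_sq_eq, Fintype.sum_prod_type]
      rw [Finset.sum_comm]
      exact Finset.sum_congr rfl fun _ _ => Finset.sum_comm
    rw [h1, h2, hg, ← Finset.sum_filter_add_sum_filter_not Finset.univ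
      (fun q : ι × ι × ι => q.1 ≠ q.2.1)]
    have h3 : ∑ q : ι × ι × ι with ¬ q.1 ≠ q.2.1, (w q.1 q.2.2 * w q.2.1 q.2.2)
        * (kmat d q.1 q.2.2 x * kmat d q.2.1 q.2.2 x)
        = ∑ q : ι × ι, w q.1 q.2 ^ 2 * kmat d q.1 q.2 x ^ 2 := by
      simp only [Finset.sum_filter, not_not, Fintype.sum_prod_type, Finset.sum_ite_irrel,
        Finset.sum_const_zero]
      refine Finset.sum_congr rfl fun i _ => ?_
      rw [Finset.sum_ite_eq]
      simp only [Finset.mem_univ, if_true]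
      exact Finset.sum_congr rfl fun j _ => by ring
    rw [h3]; ring
  have hW0 : ∀ q : ι × ι, |w q.1 q.2 ^ 2| ≤ W ^ 2 := fun q => by
    rw [abs_pow]; exact pow_le_pow_left₀ (abs_nonneg _) (hW _ _) 2
  have if2 : Integrable (fun x => f x ^ 2) (Measure.pi fun _ => F) :=
    hd.integrable_sum_sq_sub (fun q : ι × ι => w q.1 q.2 ^ 2) _
  have ig2 : Integrable (fun x => g x ^ 2) (Measure.pi fun _ => F) :=
    integrable_sum_mul_sq _ (fun q : ι × ι × ι => w q.1 q.2.2 * w q.2.1 q.2.2)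
      (Z := fun (q : ι × ι × ι) x => kmat d q.1 q.2.2 x * kmat d q.2.1 q.2.2 x)
      fun q r => hd.integrable_kmat_mul_mul _ _ _ _ _ _ _ _
  have bf := hd.integral_sum_sq_sub_le hW0
  have bg := hd.integral_sum_offdiag_sq_le hW
  have hmeas : Measurable fun x => ∑ j, row w d j x ^ 2 - 2 :=
    (Finset.measurable_sum _ fun j _ => (hd.measurable_row w j).pow_const 2).sub_const 2
  have hb : ∀ x, (∑ j, row w d j x ^ 2 - 2) ^ 2 ≤ 2 * f x ^ 2 + 2 * g x ^ 2 := fun x => by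
    rw [hsum]; nlinarith [sq_nonneg (f x - g x)]
  have hbi : Integrable (fun x => 2 * f x ^ 2 + 2 * g x ^ 2) (Measure.pi fun _ => F) :=
    (if2.const_mul 2).add (ig2.const_mul 2)
  have h2 : Integrable (fun x => (∑ j, row w d j x ^ 2 - 2) ^ 2) (Measure.pi fun _ => F) := by
    refine hbi.mono' (hmeas.pow_const 2).aestronglyMeasurable (ae_of_all _ fun x => ?_)
    rw [Real.norm_eq_abs, abs_of_nonneg (sq_nonneg _)]
    exact hb x
  refine (integral_abs_le_sqrt hmeas.aestronglyMeasurable h2).2.trans (Real.sqrt_le_sqrt ?_)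
  refine (integral_mono h2 hbi hb).trans ?_
  -- The constants come from (f + g)² ≤ 2f² + 2g²: 20 = 2·(4 + 6) in front of E d⁴ and 4 = 2·2 in
  -- front of the cycle.
  rw [integral_add (if2.const_mul 2) (ig2.const_mul 2), integral_const_mul, integral_const_mul]
  nlinarith [bf, bg]

theorem integrable_sum_row_sq (w : ι → ι → ℝ) :
    Integrable (fun x => ∑ j, row w d j x ^ 2) (Measure.pi fun _ => F) :=
  integrable_finsetSum _ fun j _ => hd.integrable_row_sq w j

/-- The mean is in fact 2, but the bound that follows from the L¹ deviation is sufficient. -/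
theorem integral_sum_row_sq_le {W : ℝ} (hW : ∀ i j, |w i j| ≤ W)
    (hnorm : (∑ q : ι × ι with q.1 ≠ q.2, w q.1 q.2 ^ 2) * kernelMoment F d 2 = 2) :
    ∫ x, ∑ j, row w d j x ^ 2 ∂(Measure.pi fun _ => F)
      ≤ 2 + √(W ^ 4 * (20 * Fintype.card ι ^ 3 * kernelMoment F d 4
        + 4 * Fintype.card ι ^ 4 * |kernelCycle F d|)) := by
  have h := hd.integral_abs_sum_row_sq_sub_le hW hnorm
  have hi := hd.integrable_sum_row_sq w
  have h1 := (le_abs_self _).trans (abs_integral_le_integral_abs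
    (f := fun x => ∑ j, row w d j x ^ 2 - 2) (μ := Measure.pi fun _ => F))
  rw [integral_sub hi (integrable_const _)] at h1
  simp only [integral_const, probReal_univ, smul_eq_mul, one_mul] at h1
  linarith

/-- A Berry–Esseen type bound, in terms of characteristic functions, for a normalized degenerate
quadratic statistic. -/
theorem norm_charFun_stat_sub_le (hw : ∀ i j, w i j = w j i) {W : ℝ} (hW : ∀ i j, |w i j| ≤ W)
    (hnorm : (∑ q : ι × ι with q.1 ≠ q.2, w q.1 q.2 ^ 2) * kernelMoment F d 2 = 2)
    {A B : ℝ} (hA : W ^ 4 * Fintype.card ι ^ 3 * kernelMoment F d 4 ≤ A)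
    (hB : W ^ 4 * Fintype.card ι ^ 4 * |kernelCycle F d| ≤ B) {δ : ℝ} (hδ : 0 < δ) (t : ℝ) :
    ‖∫ x : ι → E, Complex.exp (Complex.I * (t * stat w d x)) ∂(Measure.pi fun _ => F)
      - Complex.exp (-(t : ℂ) ^ 2 / 2)‖
      ≤ |t| * (|t| * (1 / 2 * √(20 * A + 4 * B))
        + t ^ 2 * (1 / 4 * (δ * (2 + √(20 * A + 4 * B)) + 3 * A / δ))) := by
  have hs : √(W ^ 4 * (20 * Fintype.card ι ^ 3 * kernelMoment F d 4
        + 4 * Fintype.card ι ^ 4 * |kernelCycle F d|)) ≤ √(20 * A + 4 * B) :=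
    Real.sqrt_le_sqrt (by linarith)
  have hQ := (hd.integral_abs_sum_row_sq_sub_le hW hnorm).trans hs
  have hQ2 : ∫ x, ∑ j, row w d j x ^ 2 ∂(Measure.pi fun _ => F) ≤ 2 + √(20 * A + 4 * B) :=
    (hd.integral_sum_row_sq_le hW hnorm).trans (by linarith)
  have hA0 : 0 ≤ A := le_trans (mul_nonneg (mul_nonneg (Even.pow_nonneg (by decide) W)
    (by positivity)) hd.kernelMoment_four_nonneg) hA
  have h3 : ∑ j, ∫ x, |row w d j x| ^ 3 ∂(Measure.pi fun _ => F)
      ≤ (δ * (2 + √(20 * A + 4 * B)) + 3 * A / δ) / 2 := by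
    refine (Finset.sum_le_sum fun j _ => (hd.integral_abs_row_pow_three w j hδ).2).trans ?_
    rw [← Finset.sum_div, Finset.sum_add_distrib, ← Finset.mul_sum, ← Finset.sum_div,
      ← integral_finsetSum _ fun j _ => hd.integrable_row_sq w j]
    -- There are `Fintype.card ι` rows, each bounded by 3 W⁴ `Fintype.card ι`² E d⁴.
    have h4 : ∑ j, ∫ x, row w d j x ^ 4 ∂(Measure.pi fun _ => F) ≤ 3 * A := by
      refine (Finset.sum_le_sum fun j _ => hd.integral_row_pow_four_le hW j).trans ?_
      rw [Finset.sum_const, Finset.card_univ, nsmul_eq_mul]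
      linarith
    gcongr
  have := norm_sub_gaussian_le (fun s => hd.hasDerivAt_charFun_stat w s) (by simp)
    (a := 1 / 2 * √(20 * A + 4 * B))
    (b := 1 / 4 * (δ * (2 + √(20 * A + 4 * B)) + 3 * A / δ)) (by positivity) (by positivity)
    (fun s => (hd.norm_deriv_add_mul_le hw s fun j =>
      (hd.integral_abs_row_pow_three w j hδ).1).trans (by
        have := sq_nonneg s
        have := abs_nonneg s
        have h3' : 1 / 2 * ∑ j, ∫ x, |row w d j x| ^ 3 ∂(Measure.pi fun _ => F)
            ≤ 1 / 4 * (δ * (2 + √(20 * A + 4 * B)) + 3 * A / δ) := by linarith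
        exact add_le_add (mul_le_mul_of_nonneg_left (by linarith) (abs_nonneg s))
          (mul_le_mul_of_nonneg_left h3' (sq_nonneg s)))) t
  exact this

/-- First moments are at most root mean squares, and E T² is half the mean of Σ R_j². This is what
makes T bounded in L¹ when studentizing. -/
theorem integral_abs_stat_le (hw : ∀ i j, w i j = w j i) {W : ℝ} (hW : ∀ i j, |w i j| ≤ W)
    (hnorm : (∑ q : ι × ι with q.1 ≠ q.2, w q.1 q.2 ^ 2) * kernelMoment F d 2 = 2)
    {A B : ℝ} (hA : W ^ 4 * Fintype.card ι ^ 3 * kernelMoment F d 4 ≤ A)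
    (hB : W ^ 4 * Fintype.card ι ^ 4 * |kernelCycle F d| ≤ B) :
    ∫ x : ι → E, |stat w d x| ∂(Measure.pi fun _ => F) ≤ √(1 + √(20 * A + 4 * B)) := by
  have hs : √(W ^ 4 * (20 * Fintype.card ι ^ 3 * kernelMoment F d 4
        + 4 * Fintype.card ι ^ 4 * |kernelCycle F d|)) ≤ √(20 * A + 4 * B) :=
    Real.sqrt_le_sqrt (by linarith)
  have hQ2 : ∫ x, ∑ j, row w d j x ^ 2 ∂(Measure.pi fun _ => F) ≤ 2 + √(20 * A + 4 * B) :=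
    (hd.integral_sum_row_sq_le hW hnorm).trans (by linarith)
  refine (integral_abs_le_sqrt (hd.measurable_stat w).aestronglyMeasurable
    (hd.memLp_stat w).integrable_sq).2.trans (Real.sqrt_le_sqrt ?_)
  rw [hd.integral_stat_sq hw]
  linarith [Real.sqrt_nonneg (20 * A + 4 * B)]

end IsDegenerate

end Row

/-! ### The weights of the Gini covariance -/

section Weights

variable {n K : ℕ}

/-- The weights of `gCovn` as a quadratic statistic of the pairwise distances. -/
noncomputable def giniWeight (y : Fin n → Fin K) (i j : Fin n) : ℝ :=
  (n.choose 2 : ℝ)⁻¹ - if y i = y j then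
    ((clsSize y (y i) : ℝ) / n) * ((clsSize y (y i)).choose 2 : ℝ)⁻¹ else 0

/-- The sum of the squared weights of `gCovn` over unordered pairs. -/
noncomputable def weightVar (y : Fin n → Fin K) : ℝ :=
  ∑ k, ((clsSize y k : ℝ) / n) ^ 2 * ((clsSize y k).choose 2 : ℝ)⁻¹ - (n.choose 2 : ℝ)⁻¹

theorem giniWeight_symm (y : Fin n → Fin K) (i j : Fin n) :
    giniWeight y i j = giniWeight y j i := by
  unfold giniWeight
  by_cases h : y i = y j
  · rw [if_pos h, if_pos h.symm, h]
  · rw [if_neg h, if_neg (Ne.symm h)]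

theorem clsSize_le (y : Fin n → Fin K) (k : Fin K) : clsSize y k ≤ n := by
  simpa [clsSize] using Finset.card_le_univ (cls y k)

theorem clsSize_eq_sum (y : Fin n → Fin K) (k : Fin K) :
    (clsSize y k : ℝ) = ∑ j, if k = y j then 1 else 0 := by
  rw [Finset.sum_boole, clsSize, cls]
  simp only [eq_comm (a := k)]

theorem sum_comp_label (y : Fin n → Fin K) (f : Fin K → ℝ) :
    ∑ i, f (y i) = ∑ k, clsSize y k * f k := by
  simp_rw [clsSize_eq_sum, Finset.sum_mul]
  rw [Finset.sum_comm]
  simp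

theorem sum_clsSize (y : Fin n → Fin K) : ∑ k, (clsSize y k : ℝ) = n := by
  have := sum_comp_label y fun _ => 1
  simpa using this.symm

theorem sum_lt_eq_half (S : Finset (Fin n)) {f : Fin n → Fin n → ℝ} (hf : ∀ i j, f i j = f j i)
    (h0 : ∀ i, f i i = 0) :
    ∑ i ∈ S, ∑ j ∈ S with i < j, f i j = 1 / 2 * ∑ i ∈ S, ∑ j ∈ S, f i j := by
  have h1 : ∑ i ∈ S, ∑ j ∈ S, f i j
      = ∑ i ∈ S, ∑ j ∈ S with i < j, f i j + ∑ i ∈ S, ∑ j ∈ S with j < i, f i j := by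
    rw [← Finset.sum_add_distrib]
    refine Finset.sum_congr rfl fun i _ => ?_
    rw [Finset.sum_filter, Finset.sum_filter, ← Finset.sum_add_distrib]
    refine Finset.sum_congr rfl fun j _ => ?_
    rcases lt_trichotomy i j with h | h | h
    · simp [h, h.not_gt]
    · simp [h, h0]
    · simp [h, h.not_gt]
  have h2 : ∑ i ∈ S, ∑ j ∈ S with j < i, f i j = ∑ i ∈ S, ∑ j ∈ S with i < j, f i j := by
    simp_rw [Finset.sum_filter]
    rw [Finset.sum_comm]
    exact Finset.sum_congr rfl fun i _ => Finset.sum_congr rfl fun j _ => by rw [hf]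
  rw [h1, h2]; ring

theorem gCovn_eq_sum {p : ℕ} (x : Fin n → EuclideanSpace ℝ (Fin p)) (y : Fin n → Fin K) :
    gCovn x y = 1 / 2 * ∑ i, ∑ j, giniWeight y i j * ‖x i - x j‖ := by
  have hU : ∀ S : Finset (Fin n), gmdU x S
      = 1 / 2 * ((S.card.choose 2 : ℝ)⁻¹ * ∑ i ∈ S, ∑ j ∈ S, ‖x i - x j‖) := fun S => by
    rw [gmdU, sum_lt_eq_half S (f := fun i j => ‖x i - x j‖) (fun i j => norm_sub_rev _ _)
      (fun i => by simp)]
    ring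
  have hk : ∑ k, ((clsSize y k : ℝ) / n) * gmdU x (cls y k)
      = 1 / 2 * ∑ i, ∑ j, (if y i = y j then
        ((clsSize y (y i) : ℝ) / n) * ((clsSize y (y i)).choose 2 : ℝ)⁻¹ else 0)
          * ‖x i - x j‖ := by
    simp_rw [hU, cls, Finset.sum_filter]
    have h1 : ∀ k, (clsSize y k : ℝ) / n * (1 / 2 *
        (((Finset.univ.filter fun i => y i = k).card.choose 2 : ℝ)⁻¹ *
          ∑ i, if y i = k then ∑ j, if y j = k then ‖x i - x j‖ else 0 else 0))
        = 1 / 2 * ∑ i, ∑ j, if y i = k then if y j = k then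
          ((clsSize y k : ℝ) / n) * ((clsSize y k).choose 2 : ℝ)⁻¹ * ‖x i - x j‖ else 0 else 0 := by
      intro k
      simp_rw [Finset.mul_sum]
      refine Finset.sum_congr rfl fun i _ => ?_
      by_cases h : y i = k
      · simp only [h, if_true, Finset.mul_sum, mul_ite, mul_zero]
        refine Finset.sum_congr rfl fun j _ => ?_
        by_cases h' : y j = k
        · simp only [h', if_true, clsSize, cls]; ring
        · simp [h']
      · simp [h]
    simp_rw [h1]
    rw [← Finset.mul_sum]
    congr 1
    rw [Finset.sum_comm]
    refine Finset.sum_congr rfl fun i _ => ?_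
    rw [Finset.sum_comm]
    refine Finset.sum_congr rfl fun j _ => ?_
    rw [Finset.sum_ite_eq]
    simp only [Finset.mem_univ, if_true, eq_comm (a := y j)]
    split_ifs <;> simp
  rw [gCovn, hk, hU, Finset.card_univ, Fintype.card_fin, ← mul_sub, Finset.mul_sum,
    ← Finset.sum_sub_distrib]
  congr 1
  refine Finset.sum_congr rfl fun i _ => ?_
  rw [Finset.mul_sum, ← Finset.sum_sub_distrib]
  refine Finset.sum_congr rfl fun j _ => ?_
  rw [giniWeight]; ring

variable {y : Fin n → Fin K}

theorem classCoeff_eq (hy : ∀ k, 2 ≤ clsSize y k) (k : Fin K) :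
    ((clsSize y k : ℝ) / n) * ((clsSize y k).choose 2 : ℝ)⁻¹
      = 2 / (n * ((clsSize y k : ℝ) - 1)) := by
  have h2 : (2 : ℝ) ≤ clsSize y k := by exact_mod_cast hy k
  have hn : (2 : ℝ) ≤ n := h2.trans (by exact_mod_cast clsSize_le y k)
  rw [Nat.cast_choose_two]
  have : (clsSize y k : ℝ) - 1 ≠ 0 := by linarith
  have : (clsSize y k : ℝ) ≠ 0 := by linarith
  have : (n : ℝ) ≠ 0 := by linarith
  field_simp

/-- Equivalently, the off-diagonal weights of a row sum to zero: the overall average and the class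
average each contribute 2/n. The diagonal weight is immaterial, as it multiplies a zero distance. -/
theorem sum_giniWeight (hy : ∀ k, 2 ≤ clsSize y k) (i : Fin n) :
    ∑ j, giniWeight y i j = giniWeight y i i := by
  have h2 : (2 : ℝ) ≤ clsSize y (y i) := by exact_mod_cast hy (y i)
  have hn : (2 : ℝ) ≤ n := h2.trans (by exact_mod_cast clsSize_le y (y i))
  simp only [giniWeight, classCoeff_eq hy]
  rw [Finset.sum_sub_distrib]
  have : ∑ j, (if y i = y j then 2 / ((n : ℝ) * (clsSize y (y i) - 1)) else 0)
      = clsSize y (y i) * (2 / ((n : ℝ) * (clsSize y (y i) - 1))) := by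
    rw [clsSize_eq_sum y (y i), Finset.sum_mul]
    simp
  rw [this]
  have : (clsSize y (y i) : ℝ) - 1 ≠ 0 := by linarith
  have : (n : ℝ) ≠ 0 := by linarith
  have : (n : ℝ) - 1 ≠ 0 := by linarith
  simp [Nat.cast_choose_two]
  field_simp
  ring

/-- Over unordered pairs, with b the inverse of `n.choose 2`, the cross terms give -2b Σ n_k/n = -2b
and the squares of b give +b. The factor 2 comes from ordered pairs. -/
theorem sum_giniWeight_sq (hK : 0 < K) (hy : ∀ k, 2 ≤ clsSize y k) :
    ∑ q : Fin n × Fin n with q.1 ≠ q.2, giniWeight y q.1 q.2 ^ 2 = 2 * weightVar y := by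
  have h2 : ∀ k, (2 : ℝ) ≤ clsSize y k := fun k => by exact_mod_cast hy k
  have hn : (2 : ℝ) ≤ n := (h2 ⟨0, hK⟩).trans (by exact_mod_cast clsSize_le y ⟨0, hK⟩)
  set b : ℝ := (n.choose 2 : ℝ)⁻¹ with hb
  set c : Fin K → ℝ := fun k => ((clsSize y k : ℝ) / n) * ((clsSize y k).choose 2 : ℝ)⁻¹ with hc
  have e : ∀ i j, giniWeight y i j ^ 2
      = b ^ 2 + (if y i = y j then c (y i) ^ 2 - 2 * b * c (y i) else 0) := fun i j => by
    unfold giniWeight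
    split_ifs <;> ring
  have hdiag : ∀ f : Fin n → Fin n → ℝ, ∑ q : Fin n × Fin n with q.1 ≠ q.2, f q.1 q.2
      = ∑ i, ∑ j, f i j - ∑ i, f i i := fun f => by
    rw [Finset.sum_filter, Fintype.sum_prod_type, ← Finset.sum_sub_distrib]
    refine Finset.sum_congr rfl fun i _ => ?_
    rw [← Finset.sum_filter, ← Finset.add_sum_erase _ _ (Finset.mem_univ i), add_sub_cancel_left]
    refine Finset.sum_congr ?_ fun _ _ => rfl
    ext j; simp [eq_comm]
  rw [hdiag fun i j => giniWeight y i j ^ 2]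
  simp_rw [e]
  have h3 : ∀ i, ∑ j, (if y i = y j then c (y i) ^ 2 - 2 * b * c (y i) else 0)
      = clsSize y (y i) * (c (y i) ^ 2 - 2 * b * c (y i)) := fun i => by
    rw [clsSize_eq_sum y (y i), Finset.sum_mul]
    simp
  simp only [Finset.sum_add_distrib, h3, if_true]
  rw [sum_comp_label y fun k => clsSize y k * (c k ^ 2 - 2 * b * c k),
    sum_comp_label y fun k => c k ^ 2 - 2 * b * c k]
  simp only [Finset.sum_const, Finset.card_univ, Fintype.card_fin, nsmul_eq_mul]
  have hbn : (n : ℝ) * (n - 1) * b = 2 := by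
    rw [hb, Nat.cast_choose_two]
    have : (n : ℝ) ≠ 0 := by linarith
    have : (n : ℝ) - 1 ≠ 0 := by linarith
    field_simp
  have h4 : ∀ k, clsSize y k * (clsSize y k * (c k ^ 2 - 2 * b * c k))
      - clsSize y k * (c k ^ 2 - 2 * b * c k)
      = 2 * (((clsSize y k : ℝ) / n) ^ 2 * ((clsSize y k).choose 2 : ℝ)⁻¹)
        - 4 * b / n * clsSize y k := fun k => by
    have hck : (clsSize y k : ℝ) * (clsSize y k - 1) * c k = 2 * (clsSize y k / n) := by
      simp only [hc, classCoeff_eq hy]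
      have : (clsSize y k : ℝ) - 1 ≠ 0 := by linarith [h2 k]
      have : (n : ℝ) ≠ 0 := by linarith
      field_simp
    have hck' : ((clsSize y k : ℝ) / n) ^ 2 * ((clsSize y k).choose 2 : ℝ)⁻¹
        = clsSize y k / n * c k := by simp only [hc]; ring
    rw [hck']
    linear_combination (c k - 2 * b) * hck
  have h5 : ∑ k, clsSize y k * (clsSize y k * (c k ^ 2 - 2 * b * c k))
      - ∑ k, clsSize y k * (c k ^ 2 - 2 * b * c k)
      = 2 * ∑ k, ((clsSize y k : ℝ) / n) ^ 2 * ((clsSize y k).choose 2 : ℝ)⁻¹ - 4 * b := by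
    rw [← Finset.sum_sub_distrib, Finset.sum_congr rfl fun k _ => h4 k, Finset.sum_sub_distrib,
      ← Finset.mul_sum, ← Finset.mul_sum, sum_clsSize]
    have : (n : ℝ) ≠ 0 := by linarith
    field_simp
  rw [weightVar]
  linear_combination h5 + b * hbn

/-- Each class term is at least 2/(n(n - 1)), because n_k ≤ n. Two classes suffice to leave one such
term after the subtraction. -/
theorem two_div_sq_le_weightVar (hK : 2 ≤ K) (hy : ∀ k, 2 ≤ clsSize y k) :
    2 / (n : ℝ) ^ 2 ≤ weightVar y := by
  have h2 : ∀ k, (2 : ℝ) ≤ clsSize y k := fun k => by exact_mod_cast hy k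
  have hle : ∀ k, (clsSize y k : ℝ) ≤ n := fun k => by exact_mod_cast clsSize_le y k
  have hn : (2 : ℝ) ≤ n := (h2 ⟨0, by omega⟩).trans (hle _)
  have hK' : (2 : ℝ) ≤ K := by exact_mod_cast hK
  have hterm : ∀ k, 2 / ((n : ℝ) * (n - 1))
      ≤ ((clsSize y k : ℝ) / n) ^ 2 * ((clsSize y k).choose 2 : ℝ)⁻¹ := fun k => by
    have h3 := h2 k
    have h4 := hle k
    have e : ((clsSize y k : ℝ) / n) ^ 2 * ((clsSize y k).choose 2 : ℝ)⁻¹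
        = clsSize y k / n * (2 / (n * ((clsSize y k : ℝ) - 1))) := by
      rw [← classCoeff_eq hy k]; ring
    rw [e, div_mul_div_comm, div_le_div_iff₀ (mul_pos (by linarith) (by linarith))
      (mul_pos (by linarith) (mul_pos (by linarith) (by linarith)))]
    have : 0 ≤ (n : ℝ) * 2 * (n - clsSize y k) := by
      have := sub_nonneg.2 h4
      positivity
    nlinarith
  have hsum : (K : ℝ) * (2 / ((n : ℝ) * (n - 1)))
      ≤ ∑ k, ((clsSize y k : ℝ) / n) ^ 2 * ((clsSize y k).choose 2 : ℝ)⁻¹ := by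
    have := Finset.card_nsmul_le_sum Finset.univ _ _ fun k _ => hterm k
    simpa using this
  have hb : (n.choose 2 : ℝ)⁻¹ = 2 / ((n : ℝ) * (n - 1)) := by
    rw [Nat.cast_choose_two]; simp
  have hpos : 0 < 2 / ((n : ℝ) * (n - 1)) := div_pos two_pos (mul_pos (by linarith) (by linarith))
  have h6 : 2 / (n : ℝ) ^ 2 ≤ 2 / ((n : ℝ) * (n - 1)) :=
    div_le_div_of_nonneg_left two_pos.le (mul_pos (by linarith) (by linarith)) (by nlinarith)
  rw [weightVar, hb]
  nlinarith

/-- The class coefficient dominates, and n_k - 1 ≥ n_k/2 ≥ cn/2 since n_k ≥ 2. -/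
theorem abs_giniWeight_le {c : ℝ} (hc : 0 < c) (hy : ∀ k, 2 ≤ clsSize y k)
    (hcy : ∀ k, c * n ≤ clsSize y k) (i j : Fin n) :
    |giniWeight y i j| ≤ 4 / (c * (n : ℝ) ^ 2) := by
  have h2 : (2 : ℝ) ≤ clsSize y (y i) := by exact_mod_cast hy (y i)
  have hle : (clsSize y (y i) : ℝ) ≤ n := by exact_mod_cast clsSize_le y (y i)
  have hn : (2 : ℝ) ≤ n := h2.trans hle
  have h3 : 2 / (n * ((clsSize y (y i) : ℝ) - 1)) ≤ 4 / (c * (n : ℝ) ^ 2) := by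
    rw [div_le_div_iff₀ (mul_pos (by linarith) (by linarith)) (by positivity)]
    have := hcy (y i)
    have h4 : c * n ≤ 2 * (clsSize y (y i) - 1) := by linarith
    nlinarith
  have h5 : 2 / ((n : ℝ) * (n - 1)) ≤ 2 / (n * ((clsSize y (y i) : ℝ) - 1)) := by
    refine div_le_div_of_nonneg_left two_pos.le (mul_pos (by linarith) (by linarith)) ?_
    gcongr
  have h6 : 0 < 2 / ((n : ℝ) * (n - 1)) := div_pos two_pos (mul_pos (by linarith) (by linarith))
  have hb : (n.choose 2 : ℝ)⁻¹ = 2 / ((n : ℝ) * (n - 1)) := by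
    rw [Nat.cast_choose_two]; simp
  rw [giniWeight, classCoeff_eq hy, hb, abs_le]
  split_ifs <;> constructor <;> linarith

end Weights

/-! ### Removing additive terms from the distances -/

section CenteredDistance

variable {n : ℕ} {D f : Fin n → Fin n → ℝ} {h : Fin n → ℝ}

theorem sum_mul_off_diag_eq (hD : ∀ i, D i i = 0) (hf0 : ∀ i, f i i = 0)
    (hf : ∀ i j, i ≠ j → f i j = D i j + h i + h j) {w : Fin n → Fin n → ℝ}
    (hw : ∀ i j, w i j = w j i) (hsum : ∀ i, ∑ j, w i j = w i i) :
    ∑ i, ∑ j, w i j * f i j = ∑ i, ∑ j, w i j * D i j := by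
  have e : ∀ i j, w i j * f i j
      -- The additive splitting fails on the diagonal, where `f` and `D` vanish; the last term
      -- corrects for it.
      = w i j * D i j + h i * w i j + h j * w i j - if i = j then 2 * h i * w i i else 0 :=
    fun i j => by
      by_cases hij : i = j
      · subst hij; rw [hf0, hD, if_pos rfl]; ring
      · rw [hf i j hij, if_neg hij]; ring
  have h2 : ∑ i, ∑ j, h j * w i j = ∑ i, h i * w i i := by
    rw [Finset.sum_comm]
    refine Finset.sum_congr rfl fun i _ => ?_
    rw [← Finset.mul_sum, ← hsum i]
    simp only [hw i]
  simp_rw [e]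
  simp only [Finset.sum_sub_distrib, Finset.sum_add_distrib, h2, ← Finset.mul_sum, hsum,
    Finset.sum_ite_eq, Finset.mem_univ, if_true]
  rw [add_assoc, ← Finset.sum_add_distrib, add_sub_assoc, ← Finset.sum_sub_distrib]
  rw [Finset.sum_eq_zero (f := fun i => h i * w i i + h i * w i i - 2 * h i * w i i)
    fun i _ => by ring, add_zero]

theorem sum_off_diag_row (hD : ∀ i, D i i = 0) (hf0 : ∀ i, f i i = 0)
    (hf : ∀ i j, i ≠ j → f i j = D i j + h i + h j) (i : Fin n) :
    ∑ j, f i j = ∑ j, D i j + ((n : ℝ) - 2) * h i + ∑ j, h j := by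
  have e : ∀ j, f i j = D i j + h i + h j - if i = j then 2 * h i else 0 := fun j => by
    by_cases hij : i = j
    · subst hij; rw [hf0, hD, if_pos rfl]; ring
    · rw [hf i j hij, if_neg hij]; ring
  simp_rw [e]
  simp only [Finset.sum_sub_distrib, Finset.sum_add_distrib, Finset.sum_ite_eq, Finset.mem_univ,
    if_true, Finset.sum_const, Finset.card_univ, Fintype.card_fin, nsmul_eq_mul]
  ring

/-- The sum of squares of a `U`-centered matrix. -/
theorem sum_sq_off_diag_centered (hn : 3 ≤ n) (hDs : ∀ i j, D i j = D j i) (hD : ∀ i, D i i = 0) :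
    ∑ k, ∑ l with k ≠ l, (D k l - 1 / ((n : ℝ) - 2) * ∑ i, D l i - 1 / ((n : ℝ) - 2) * ∑ j, D k j
      + 1 / (((n : ℝ) - 1) * ((n : ℝ) - 2)) * ∑ i, ∑ j, D i j) ^ 2
      = ∑ k, ∑ l, D k l ^ 2 - 2 / ((n : ℝ) - 2) * ∑ k, (∑ j, D k j) ^ 2
        + 1 / (((n : ℝ) - 1) * ((n : ℝ) - 2)) * (∑ i, ∑ j, D i j) ^ 2 := by
  have hn' : (3 : ℝ) ≤ n := by exact_mod_cast hn
  have hn1 : (n : ℝ) - 1 ≠ 0 := by linarith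
  have hn2 : (n : ℝ) - 2 ≠ 0 := by linarith
  set r : Fin n → ℝ := fun k => ∑ j, D k j with hr
  set s : ℝ := ∑ k, r k with hs
  set a : ℝ := 1 / ((n : ℝ) - 2) with ha
  set e : ℝ := 1 / (((n : ℝ) - 1) * ((n : ℝ) - 2)) * s with he
  have h1 : ∀ k, ∑ l with k ≠ l, (D k l - a * r l - a * r k + e) ^ 2
      = ∑ l, (D k l - a * r l - a * r k + e) ^ 2 - (e - 2 * a * r k) ^ 2 := fun k => by
    rw [← Finset.add_sum_erase _ _ (Finset.mem_univ k), hD]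
    have : (0 - a * r k - a * r k + e) ^ 2 = (e - 2 * a * r k) ^ 2 := by ring
    rw [this, add_sub_cancel_left]
    refine Finset.sum_congr ?_ fun _ _ => rfl
    ext j; simp [eq_comm]
  have h2 : ∀ k l, (D k l - a * r l - a * r k + e) ^ 2
      = D k l ^ 2 + a ^ 2 * r l ^ 2 + a ^ 2 * r k ^ 2 + e ^ 2 - 2 * a * (D k l * r l)
        - 2 * a * r k * D k l + 2 * e * D k l + 2 * a ^ 2 * r k * r l - 2 * a * e * r l
        - 2 * a * e * r k := fun k l => by ring
  have h3 : ∑ k, ∑ l, D k l * r l = ∑ k, r k ^ 2 := by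
    rw [Finset.sum_comm]
    refine Finset.sum_congr rfl fun l _ => ?_
    rw [← Finset.sum_mul, sq]
    congr 1
    exact Finset.sum_congr rfl fun k _ => hDs k l
  have h4 : ∑ k, ∑ l, (D k l - a * r l - a * r k + e) ^ 2
      = ∑ k, ∑ l, D k l ^ 2 + 2 * n * a ^ 2 * ∑ k, r k ^ 2 + n ^ 2 * e ^ 2
        - 4 * a * ∑ k, r k ^ 2 + 2 * e * s + 2 * a ^ 2 * s ^ 2 - 4 * a * e * n * s := by
    simp_rw [h2]
    simp only [Finset.sum_sub_distrib, Finset.sum_add_distrib, ← Finset.mul_sum, h3,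
      Finset.sum_const, Finset.card_univ, Fintype.card_fin, nsmul_eq_mul]
    have h5 : ∑ k, r k * ∑ l, D k l = ∑ k, r k ^ 2 :=
      Finset.sum_congr rfl fun k _ => (sq (r k)).symm
    have h6 : ∑ k, 2 * a * r k * ∑ l, D k l = 2 * a * ∑ k, r k ^ 2 := by
      rw [← h5, Finset.mul_sum]; exact Finset.sum_congr rfl fun k _ => by ring
    have h7 : ∑ k, 2 * a ^ 2 * r k * s = 2 * a ^ 2 * s ^ 2 := by
      rw [← Finset.sum_mul, ← Finset.mul_sum]; ring
    have h8 : ∑ k, ∑ l, D k l = s := rfl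
    rw [h6, h8, h7]
    ring
  have h5 : ∑ k, (e - 2 * a * r k) ^ 2 = n * e ^ 2 - 4 * a * e * s + 4 * a ^ 2 * ∑ k, r k ^ 2 := by
    have : ∀ k, (e - 2 * a * r k) ^ 2 = e ^ 2 - 4 * a * e * r k + 4 * a ^ 2 * r k ^ 2 :=
      fun k => by ring
    simp_rw [this]
    simp only [Finset.sum_sub_distrib, Finset.sum_add_distrib, ← Finset.mul_sum,
      Finset.sum_const, Finset.card_univ, Fintype.card_fin, nsmul_eq_mul]
    rfl
  change ∑ k, ∑ l with k ≠ l, (D k l - a * r l - a * r k + e) ^ 2 = _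
  rw [Finset.sum_congr rfl fun k _ => h1 k, Finset.sum_sub_distrib, h4, h5, he, ha]
  field_simp
  ring

/-- U-centering annihilates every additive term h_i + h_j off the diagonal, so V_n² may be computed
from the kernel d. -/
theorem dVarn_eq {p : ℕ} {x : Fin n → EuclideanSpace ℝ (Fin p)} (hn : 3 ≤ n)
    (hDs : ∀ i j, D i j = D j i) (hD : ∀ i, D i i = 0)
    (hf : ∀ i j, i ≠ j → ‖x i - x j‖ = D i j + h i + h j) :
    dVarn x = 1 / ((n : ℝ) * ((n : ℝ) - 3)) * (∑ k, ∑ l, D k l ^ 2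
        - 2 / ((n : ℝ) - 2) * ∑ k, (∑ j, D k j) ^ 2
        + 1 / (((n : ℝ) - 1) * ((n : ℝ) - 2)) * (∑ i, ∑ j, D i j) ^ 2) := by
  have hn' : (3 : ℝ) ≤ n := by exact_mod_cast hn
  have hn1 : (n : ℝ) - 1 ≠ 0 := by linarith
  have hn2 : (n : ℝ) - 2 ≠ 0 := by linarith
  rw [dVarn, ← sum_sq_off_diag_centered hn hDs hD]
  congr 1
  refine Finset.sum_congr rfl fun k _ => Finset.sum_congr rfl fun l hl => ?_
  have hkl : k ≠ l := (Finset.mem_filter.1 hl).2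
  have hrow := sum_off_diag_row (f := fun i j => ‖x i - x j‖) hD (fun i => by simp) hf
  have hcol : ∑ i, ‖x i - x l‖ = ∑ i, ‖x l - x i‖ :=
    Finset.sum_congr rfl fun i _ => norm_sub_rev _ _
  have htot : ∑ i, ∑ j, ‖x i - x j‖
      = ∑ i, ∑ j, D i j + 2 * ((n : ℝ) - 1) * ∑ i, h i := by
    simp only [hrow, Finset.sum_add_distrib, ← Finset.mul_sum, Finset.sum_const, Finset.card_univ,
      Fintype.card_fin, nsmul_eq_mul]
    ring
  rw [centDist, hcol, hrow k, hrow l, htot, hf k l hkl]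
  congr 1
  field_simp
  ring

end CenteredDistance

/-! ### The double centered distance as a degenerate kernel -/

section Dcd

variable {p : ℕ} {F : Measure (EuclideanSpace ℝ (Fin p))} [IsProbabilityMeasure F]

/-- The centering term of `dcd`. -/
noncomputable def dcdShift (F : Measure (EuclideanSpace ℝ (Fin p))) (x : EuclideanSpace ℝ (Fin p)) :
    ℝ :=
  (∫ z, ‖x - z‖ ∂F) - (∫ z, ∫ w, ‖z - w‖ ∂F ∂F) / 2

-- Splitting the constant E‖X - X'‖ evenly between the two points makes the difference between
-- distance and kernel additive.
omit [IsProbabilityMeasure F] in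
theorem norm_sub_eq_dcd_add (x y : EuclideanSpace ℝ (Fin p)) :
    ‖x - y‖ = dcd F x y + dcdShift F x + dcdShift F y := by
  unfold dcd dcdShift
  simp only [norm_sub_rev _ y]
  ring

theorem isDegenerate_dcd (hF : Integrable (fun x => ‖x‖ ^ 4) F) : IsDegenerate F (dcd F) := by
  have h1 : Integrable (fun x : EuclideanSpace ℝ (Fin p) => ‖x‖) F := by
    refine ((integrable_const (1 : ℝ)).add hF).mono' (by fun_prop) (ae_of_all _ fun x => ?_)
    simp only [Real.norm_eq_abs, abs_norm, Pi.add_apply]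
    nlinarith [sq_nonneg (‖x‖ - 1), sq_nonneg (‖x‖ ^ 2 - 1), sq_nonneg (‖x‖ ^ 2)]
  set M := ∫ z, ‖z‖ ∂F with hM
  have hM0 : 0 ≤ M := integral_nonneg fun z => norm_nonneg z
  have h2 : ∀ x : EuclideanSpace ℝ (Fin p), Integrable (fun z => ‖x - z‖) F := fun x => by
    refine ((integrable_const ‖x‖).add h1).mono' (by fun_prop) (ae_of_all _ fun z => ?_)
    simp only [Real.norm_eq_abs, abs_norm, Pi.add_apply]
    exact norm_sub_le x z
  set g : EuclideanSpace ℝ (Fin p) → ℝ := fun x => ∫ z, ‖x - z‖ ∂F with hg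
  have hg0 : ∀ x, 0 ≤ g x := fun x => integral_nonneg fun z => norm_nonneg _
  have hg1 : ∀ x, g x ≤ ‖x‖ + M := fun x => by
    have := integral_mono (h2 x) ((integrable_const ‖x‖).add h1) fun z => norm_sub_le x z
    rw [integral_add' (integrable_const _) h1] at this
    simpa using this
  have hgm : Measurable g := by
    refine (StronglyMeasurable.integral_prod_right
      (f := fun x z : EuclideanSpace ℝ (Fin p) => ‖x - z‖) ?_).measurable
    exact Measurable.stronglyMeasurable (by fun_prop)
  have hgi : Integrable g F := by
    refine (h1.add (integrable_const M)).mono' hgm.aestronglyMeasurable (ae_of_all _ fun x => ?_)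
    rw [Real.norm_eq_abs, abs_of_nonneg (hg0 x)]
    exact hg1 x
  set Δ := ∫ z, g z ∂F with hΔ
  have hΔ0 : 0 ≤ Δ := integral_nonneg hg0
  have hΔ1 : Δ ≤ 2 * M := by
    have := integral_mono hgi (h1.add (integrable_const M)) hg1
    rw [integral_add' h1 (integrable_const _)] at this
    simp only [integral_const, probReal_univ, smul_eq_mul, one_mul] at this
    linarith
  have hd : ∀ x y, dcd F x y = ‖x - y‖ - g x - g y + Δ := fun x y => by
    simp only [dcd, norm_sub_rev _ y, hg, hΔ]
  have hm : Measurable (Function.uncurry (dcd F)) := by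
    have : Function.uncurry (dcd F) = fun q => ‖q.1 - q.2‖ - g q.1 - g q.2 + Δ := by
      funext q; exact hd q.1 q.2
    rw [this]
    fun_prop
  refine ⟨hm, fun x y => ?_, fun x => ?_, ?_⟩
  · rw [hd, hd, norm_sub_rev]; ring
  · simp only [hd]
    have i1 : Integrable (fun z => ‖x - z‖ - g x) F := (h2 x).sub (integrable_const _)
    have i2 : Integrable (fun z => ‖x - z‖ - g x - g z) F := i1.sub hgi
    rw [integral_add i2 (integrable_const _), integral_sub i1 hgi,
      integral_sub (h2 x) (integrable_const _)]
    simp only [integral_const, probReal_univ, smul_eq_mul, one_mul]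
    simp only [hΔ, hg]
    ring
  · have i1 : Integrable (fun q : EuclideanSpace ℝ (Fin p) × EuclideanSpace ℝ (Fin p) =>
        27 * (‖q.1‖ ^ 4 + ‖q.2‖ ^ 4 + (2 * M) ^ 4)) (F.prod F) :=
      (((hF.comp_fst F).add (hF.comp_snd F)).add (integrable_const _)).const_mul 27
    refine i1.mono' (hm.pow_const 4).aestronglyMeasurable (ae_of_all _ fun q => ?_)
    -- With M = E‖X‖, use 0 ≤ E‖x - X‖ ≤ ‖x‖ + M and 0 ≤ E‖X - X'‖ ≤ 2M. The factor 27 then comes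
    -- from (a + b + c)⁴ ≤ 27(a⁴ + b⁴ + c⁴).
    have hb : |dcd F q.1 q.2| ≤ ‖q.1‖ + ‖q.2‖ + 2 * M := by
      rw [hd, abs_le]
      have := norm_sub_le q.1 q.2
      have := norm_nonneg (q.1 - q.2)
      constructor <;> linarith [hg0 q.1, hg0 q.2, hg1 q.1, hg1 q.2]
    rw [Real.norm_eq_abs, abs_pow]
    refine (pow_le_pow_left₀ (abs_nonneg _) hb 4).trans ?_
    generalize ‖q.1‖ = a
    generalize ‖q.2‖ = b
    generalize 2 * M = c
    have s1 : (a + b + c) ^ 2 ≤ 3 * (a ^ 2 + b ^ 2 + c ^ 2) := by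
      nlinarith [sq_nonneg (a - b), sq_nonneg (b - c), sq_nonneg (a - c)]
    have s2 : (a ^ 2 + b ^ 2 + c ^ 2) ^ 2 ≤ 3 * (a ^ 4 + b ^ 4 + c ^ 4) := by
      nlinarith [sq_nonneg (a ^ 2 - b ^ 2), sq_nonneg (b ^ 2 - c ^ 2), sq_nonneg (a ^ 2 - c ^ 2)]
    have s3 := pow_le_pow_left₀ (sq_nonneg (a + b + c)) s1 2
    nlinarith

end Dcd

/-! ### Consistency of the estimated distance variance -/

namespace IsDegenerate

variable {ι E : Type*} [Fintype ι] [DecidableEq ι] [MeasurableSpace E]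
  {F : Measure E} [IsProbabilityMeasure F] {d : E → E → ℝ} (hd : IsDegenerate F d)
include hd

/-- Distinct terms of a row are uncorrelated, so only the diagonal of the expanded square remains.
-/
theorem integral_row_sq_le {w : ι → ι → ℝ} {W : ℝ} (hW : ∀ i j, |w i j| ≤ W) (j : ι) :
    ∫ x, row w d j x ^ 2 ∂(Measure.pi fun _ => F)
      ≤ W ^ 2 * (Fintype.card ι * kernelMoment F d 2) := by
  have hm := hd.kernelMoment_two_nonneg
  unfold row
  refine (integral_sum_mul_sq_le (Z := fun i => kmat d i j)
    (B := fun i k => if i = k then kernelMoment F d 2 else 0) Finset.univ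
    (fun i k => (hd.memLp_kmat i j).integrable_mul (hd.memLp_kmat k j)) (fun i _ => hW i j)
    fun i _ k _ => ?_).trans_eq ?_
  · by_cases hij : i = j
    · simp only [hij, kmat_self, zero_mul, integral_zero, abs_zero]
      split_ifs <;> first | exact hm | exact le_rfl
    by_cases hik : i = k
    · subst hik
      simp only [if_true, ← sq]
      rw [hd.integral_kmat_sq hij, abs_of_nonneg hm]
    · rw [hd.integral_kmat_mul_eq_zero i j fun x z =>
        kmat_update_of_ne d (Ne.symm hik) (Ne.symm hij) x z, abs_zero, if_neg hik]
  · simp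

end IsDegenerate

section Variance

variable {p n : ℕ} {F : Measure (EuclideanSpace ℝ (Fin p))} [IsProbabilityMeasure F]

/-- The bias-corrected distance variance is close to its mean. -/
theorem integral_abs_dVarn_sub_le (hF : Integrable (fun x => ‖x‖ ^ 4) F) (hn : 6 ≤ n) :
    Integrable (fun x : Fin n → EuclideanSpace ℝ (Fin p) => |dVarn x - dcdMoment F 2|)
      (Measure.pi fun _ => F) ∧
    ∫ x : Fin n → EuclideanSpace ℝ (Fin p), |dVarn x - dcdMoment F 2| ∂(Measure.pi fun _ => F)
      ≤ 2 / (n : ℝ) ^ 2 * (√(4 * n ^ 3 * dcdMoment F 4) + 6 * n * dcdMoment F 2) := by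
  have hd := isDegenerate_dcd hF
  have hn' : (6 : ℝ) ≤ n := by exact_mod_cast hn
  have hm2 : 0 ≤ dcdMoment F 2 := hd.kernelMoment_two_nonneg
  set m := dcdMoment F 2 with hm
  set w : Fin n → Fin n → ℝ := fun _ _ => 1 with hw
  have hW : ∀ i j, |w i j| ≤ 1 := fun i j => by simp [hw]
  set f : (Fin n → EuclideanSpace ℝ (Fin p)) → ℝ := fun x =>
    ∑ q : Fin n × Fin n with q.1 ≠ q.2, (1 : ℝ) * (kmat (dcd F) q.1 q.2 x ^ 2 - m) with hf
  set Q : (Fin n → EuclideanSpace ℝ (Fin p)) → ℝ := fun x => ∑ j, row w (dcd F) j x ^ 2 with hQ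
  set S : (Fin n → EuclideanSpace ℝ (Fin p)) → ℝ := stat w (dcd F) with hS
  have hmf : Measurable f := Finset.measurable_sum _ fun q _ =>
    (((hd.measurable_kmat q.1 q.2).pow_const 2).sub_const m).const_mul 1
  have if2 : Integrable (fun x => f x ^ 2) (Measure.pi fun _ => F) :=
    hd.integrable_sum_sq_sub (fun _ => 1) _
  obtain ⟨hfi, hfb⟩ := integral_abs_le_sqrt hmf.aestronglyMeasurable if2
  have hfb' : ∫ x, |f x| ∂(Measure.pi fun _ => F) ≤ √(4 * n ^ 3 * dcdMoment F 4) := by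
    refine hfb.trans (Real.sqrt_le_sqrt ?_)
    have := hd.integral_sum_sq_sub_le (ι := Fin n) (a := fun _ => 1) (A := 1) (by simp)
    exact this.trans_eq (by rw [Fintype.card_fin, one_pow, one_mul]; rfl)
  have hQi : Integrable Q (Measure.pi fun _ => F) := hd.integrable_sum_row_sq w
  have hQb : ∫ x, Q x ∂(Measure.pi fun _ => F) ≤ n ^ 2 * m := by
    rw [hQ, integral_finsetSum _ fun j _ => hd.integrable_row_sq w j]
    refine (Finset.sum_le_sum fun j _ => hd.integral_row_sq_le hW j).trans_eq ?_
    rw [Finset.sum_const, Finset.card_univ, Fintype.card_fin, nsmul_eq_mul]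
    change (n : ℝ) * (1 ^ 2 * (n * m)) = n ^ 2 * m
    ring
  have hSi : Integrable (fun x => S x ^ 2) (Measure.pi fun _ => F) :=
    (hd.memLp_stat w).integrable_sq
  have hSb : ∫ x, S x ^ 2 ∂(Measure.pi fun _ => F) ≤ n ^ 2 * m / 2 := by
    rw [hS, hd.integral_stat_sq (fun _ _ => rfl)]
    linarith
  have hrow : ∀ x k, ∑ j, kmat (dcd F) k j x = row w (dcd F) k x := fun x k => by
    unfold row
    exact Finset.sum_congr rfl fun j _ => by rw [hw, one_mul, hd.kmat_symm]
  -- The term 2nm is the difference between the n(n - 1) off-diagonal entries and the normalization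
  -- n(n - 3). `Q` and `S` come from the row sums and the grand total, with unit weights.
  have hV : ∀ x : Fin n → EuclideanSpace ℝ (Fin p), dVarn x - m
      = 1 / ((n : ℝ) * (n - 3)) * (f x + 2 * n * m - 2 / ((n : ℝ) - 2) * Q x
        + 4 / (((n : ℝ) - 1) * ((n : ℝ) - 2)) * S x ^ 2) := fun x => by
    rw [dVarn_eq (D := fun i j => kmat (dcd F) i j x) (h := fun i => dcdShift F (x i)) (by omega)
      (fun i j => hd.kmat_symm i j x) (fun i => kmat_self _ _ _)
      fun i j hij => by rw [kmat_of_ne _ hij]; exact norm_sub_eq_dcd_add _ _]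
    simp only [hrow]
    have h1 : f x = ∑ k, ∑ l, kmat (dcd F) k l x ^ 2 - n * (n - 1) * m := by
      simp only [hf, one_mul, Finset.sum_filter, Fintype.sum_prod_type]
      have : ∀ i j : Fin n, (if i ≠ j then kmat (dcd F) i j x ^ 2 - m else 0)
          = kmat (dcd F) i j x ^ 2 - m + if i = j then m else 0 := fun i j => by
        by_cases h : i = j
        · subst h; simp
        · simp [h]
      simp only [this, Finset.sum_add_distrib, Finset.sum_sub_distrib, Finset.sum_ite_eq,
        Finset.mem_univ, if_true, Finset.sum_const, Finset.card_univ, Fintype.card_fin,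
        nsmul_eq_mul]
      ring
    have h2 : ∑ k, row w (dcd F) k x = 2 * S x := by rw [hS, stat]; ring
    rw [h2, h1]
    have : (n : ℝ) - 3 ≠ 0 := by linarith
    have : (n : ℝ) ≠ 0 := by linarith
    have : (n : ℝ) - 2 ≠ 0 := by linarith
    have : (n : ℝ) - 1 ≠ 0 := by linarith
    field_simp
    ring
  have c0 : 0 ≤ 1 / ((n : ℝ) * (n - 3)) :=
    div_nonneg zero_le_one (mul_nonneg (by linarith) (by linarith))
  have c1 : 0 ≤ 2 / ((n : ℝ) - 2) := div_nonneg two_pos.le (by linarith)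
  have c2 : 0 ≤ 4 / (((n : ℝ) - 1) * ((n : ℝ) - 2)) :=
    div_nonneg (by norm_num) (mul_nonneg (by linarith) (by linarith))
  have hb : ∀ x : Fin n → EuclideanSpace ℝ (Fin p), |dVarn x - m|
      ≤ 1 / ((n : ℝ) * (n - 3)) * (|f x| + 2 * n * m + 2 / ((n : ℝ) - 2) * Q x
        + 4 / (((n : ℝ) - 1) * ((n : ℝ) - 2)) * S x ^ 2) := fun x => by
    rw [hV, abs_mul, abs_of_nonneg c0]
    refine mul_le_mul_of_nonneg_left ?_ c0
    have q0 : 0 ≤ 2 / ((n : ℝ) - 2) * Q x :=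
      mul_nonneg c1 (Finset.sum_nonneg fun j _ => sq_nonneg _)
    have s0 : 0 ≤ 4 / (((n : ℝ) - 1) * ((n : ℝ) - 2)) * S x ^ 2 := mul_nonneg c2 (sq_nonneg _)
    have nm : 0 ≤ 2 * n * m := by positivity
    rw [abs_le]
    constructor <;> linarith [neg_abs_le (f x), le_abs_self (f x)]
  have i1 : Integrable (fun x => |f x| + 2 * n * m) (Measure.pi fun _ => F) :=
    hfi.abs.add (integrable_const _)
  have i2 : Integrable (fun x => |f x| + 2 * n * m + 2 / ((n : ℝ) - 2) * Q x)
    (Measure.pi fun _ => F) := i1.add (hQi.const_mul _)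
  have i3 : Integrable (fun x => |f x| + 2 * n * m + 2 / ((n : ℝ) - 2) * Q x
    + 4 / (((n : ℝ) - 1) * ((n : ℝ) - 2)) * S x ^ 2) (Measure.pi fun _ => F) :=
    i2.add (hSi.const_mul _)
  have hmV : Measurable fun x : Fin n → EuclideanSpace ℝ (Fin p) => |dVarn x - m| := by
    simp only [hV]
    have := hd.measurable_stat w
    have : Measurable Q := Finset.measurable_sum _ fun j _ => (hd.measurable_row w j).pow_const 2
    fun_prop
  have hi : Integrable (fun x : Fin n → EuclideanSpace ℝ (Fin p) => |dVarn x - m|)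
      (Measure.pi fun _ => F) :=
    (i3.const_mul _).mono' hmV.aestronglyMeasurable
      (ae_of_all _ fun x => by rw [Real.norm_eq_abs, abs_abs]; exact hb x)
  refine ⟨hi, (integral_mono hi (i3.const_mul _) hb).trans ?_⟩
  rw [integral_const_mul, integral_add i2 (hSi.const_mul _), integral_add i1 (hQi.const_mul _),
    integral_add hfi.abs (integrable_const _), integral_const_mul, integral_const_mul]
  simp only [integral_const_mul, integral_const, probReal_univ, smul_eq_mul, one_mul]
  -- For n ≥ 6 the three lower-order parts are at most 2nm, 3nm and nm, which gives the 6nm of the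
  -- statement.
  have b1 : 1 / ((n : ℝ) * (n - 3)) ≤ 2 / (n : ℝ) ^ 2 := by
    rw [div_le_div_iff₀ (mul_pos (by linarith) (by linarith)) (by positivity)]
    nlinarith
  have b2 : 2 / ((n : ℝ) - 2) * ∫ x, Q x ∂(Measure.pi fun _ => F) ≤ 3 * n * m := by
    refine (mul_le_mul_of_nonneg_left hQb c1).trans ?_
    rw [div_mul_eq_mul_div, div_le_iff₀ (by linarith)]
    have : 0 ≤ (n : ℝ) * m * (n - 6) := mul_nonneg (by positivity) (by linarith)
    nlinarith
  have b3 : 4 / (((n : ℝ) - 1) * ((n : ℝ) - 2)) * ∫ x, S x ^ 2 ∂(Measure.pi fun _ => F)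
      ≤ 1 * n * m := by
    refine (mul_le_mul_of_nonneg_left hSb c2).trans ?_
    rw [div_mul_eq_mul_div, div_le_iff₀ (mul_pos (by linarith) (by linarith))]
    have : 0 ≤ (n : ℝ) * m * (n - 6) := mul_nonneg (by positivity) (by linarith)
    have : 0 ≤ (n : ℝ) * (n * m * (n - 6)) := mul_nonneg (by linarith) this
    nlinarith [mul_nonneg (by linarith : (0:ℝ) ≤ n) hm2]
  have hr := Real.sqrt_nonneg (4 * n ^ 3 * dcdMoment F 4)
  refine mul_le_mul b1 (by linarith) ?_ (by positivity)
  have : 0 ≤ ∫ x, |f x| ∂(Measure.pi fun _ => F) := integral_nonneg fun x => abs_nonneg _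
  have : 0 ≤ ∫ x, Q x ∂(Measure.pi fun _ => F) :=
    integral_nonneg fun x => Finset.sum_nonneg fun j _ => sq_nonneg _
  have : 0 ≤ ∫ x, S x ^ 2 ∂(Measure.pi fun _ => F) := integral_nonneg fun x => sq_nonneg _
  positivity

end Variance

/-! ### Replacing the variance by its estimate -/

theorem norm_exp_I_mul_sub_le (a b : ℝ) :
    ‖Complex.exp (Complex.I * a) - Complex.exp (Complex.I * b)‖ ≤ |a - b| := by
  have : Complex.exp (Complex.I * a) - Complex.exp (Complex.I * b)
      = Complex.exp (Complex.I * b) * (Complex.exp (Complex.I * ((a - b : ℝ) : ℂ)) - 1) := by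
    rw [mul_sub, ← Complex.exp_add]
    push_cast; ring_nf
  rw [this, norm_mul, mul_comm Complex.I (b : ℂ), Complex.norm_exp_ofReal_mul_I, one_mul]
  exact Real.norm_exp_I_mul_ofReal_sub_one_le

/-- Studentizing by a factor close to one changes characteristic functions little. -/
theorem norm_exp_div_sqrt_sub_le (t T r : ℝ) {ε : ℝ} (h0 : 0 < ε) (h1 : ε ≤ 1 / 2) :
    ‖Complex.exp (Complex.I * (t * (T / √r : ℝ))) - Complex.exp (Complex.I * (t * T))‖
      ≤ 2 / ε * |r - 1| + |t| * ε * |T| := by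
  rw [← Complex.ofReal_mul, ← Complex.ofReal_mul]
  by_cases h : |r - 1| ≤ ε
  · refine (norm_exp_I_mul_sub_le _ _).trans ?_
    obtain ⟨h2, h3⟩ := abs_le.1 h
    have hr : 1 / 2 ≤ r := by linarith
    have hs : 1 / 2 ≤ √r := Real.le_sqrt_of_sq_le (by linarith)
    have hsq : √r ^ 2 = r := Real.sq_sqrt (by linarith)
    have key : |1 / √r - 1| ≤ ε := by
      have e : 1 / √r - 1 = (1 - r) / (√r * (1 + √r)) := by
        rw [← hsq, Real.sqrt_sq (by linarith)]
        have : √r ≠ 0 := by linarith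
        have : 1 + √r ≠ 0 := by linarith
        field_simp
        ring
      -- Here √r(1 + √r) = r + √r, and both summands are at least 1/2.
      have hp : 1 ≤ √r * (1 + √r) := by nlinarith
      rw [e, abs_div, abs_of_pos (by linarith : 0 < √r * (1 + √r)), abs_sub_comm]
      exact (div_le_self (abs_nonneg _) hp).trans h
    have e : t * (T / √r) - t * T = t * T * (1 / √r - 1) := by ring
    rw [e, abs_mul, abs_mul]
    have : |t| * |T| * |1 / √r - 1| ≤ |t| * |T| * ε :=
      mul_le_mul_of_nonneg_left key (by positivity)
    have : 0 ≤ 2 / ε * |r - 1| := by positivity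
    linarith
  -- Off the good event the trivial bound 2 is at most (2/ε)|r - 1|, Markov's inequality in
  -- pointwise form. This also covers r ≤ 0, where the quotient takes its default value.
  · refine (norm_sub_le _ _).trans ?_
    rw [mul_comm Complex.I, mul_comm Complex.I, Complex.norm_exp_ofReal_mul_I,
      Complex.norm_exp_ofReal_mul_I]
    have : 2 ≤ 2 / ε * |r - 1| := by
      rw [div_mul_eq_mul_div, le_div_iff₀ h0]
      linarith
    have : 0 ≤ |t| * ε * |T| := by positivity
    linarith

/-! ### Quantitative limit theorem for fixed labels -/

section Studentized

variable {p n K : ℕ} {F : Measure (EuclideanSpace ℝ (Fin p))} [IsProbabilityMeasure F]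

/-- The vanishing off-diagonal row sums turn distances into kernel values. -/
theorem stat_giniWeight_eq (hF : Integrable (fun x => ‖x‖ ^ 4) F) {y : Fin n → Fin K}
    (hy : ∀ k, 2 ≤ clsSize y k) (s : ℝ) (x : Fin n → EuclideanSpace ℝ (Fin p)) :
    stat (fun i j => giniWeight y i j / s) (dcd F) x = gCovn x y / s := by
  have hd := isDegenerate_dcd hF
  rw [gCovn_eq_sum, sum_mul_off_diag_eq (D := fun i j => kmat (dcd F) i j x)
    (h := fun i => dcdShift F (x i)) (fun i => kmat_self _ _ _) (fun i => by simp)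
    (fun i j hij => by rw [kmat_of_ne _ hij]; exact norm_sub_eq_dcd_add _ _)
    (giniWeight_symm y) (sum_giniWeight hy), stat, mul_div_assoc, Finset.sum_div]
  congr 1
  refine Finset.sum_congr rfl fun j _ => ?_
  rw [row, Finset.sum_div]
  refine Finset.sum_congr rfl fun i _ => ?_
  rw [giniWeight_symm y i j, hd.kmat_symm i j]
  ring

theorem measurable_gCovn (y : Fin n → Fin K) :
    Measurable fun x : Fin n → EuclideanSpace ℝ (Fin p) => gCovn x y := by
  simp only [gCovn_eq_sum]
  fun_prop

theorem measurable_dVarn :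
    Measurable fun x : Fin n → EuclideanSpace ℝ (Fin p) => dVarn x := by
  unfold dVarn centDist
  fun_prop

theorem measurable_studGCov (y : Fin n → Fin K) :
    Measurable fun x : Fin n → EuclideanSpace ℝ (Fin p) => studGCov x y := by
  unfold studGCov varHat
  exact (measurable_gCovn y).div ((measurable_dVarn.const_mul _).sqrt)

/-- A quantitative central limit theorem for the studentized Gini covariance. -/
theorem norm_charFun_studGCov_sub_le (hK : 2 ≤ K) (hF : Integrable (fun x => ‖x‖ ^ 4) F)
    (hpos : 0 < dcdMoment F 2) (hn : 6 ≤ n) {y : Fin n → Fin K} (hy : ∀ k, 2 ≤ clsSize y k)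
    {c : ℝ} (hc : 0 < c) (hcy : ∀ k, c * n ≤ clsSize y k) {s : ℝ} (hs : 0 < s) (hs1 : s ≤ 1 / 2)
    (hns : 12 / (n : ℝ) ≤ s ^ 2) (h4 : dcdMoment F 4 / (n * dcdMoment F 2 ^ 2) ≤ s ^ 4)
    (hcyc : |dcdCycle F| / dcdMoment F 2 ^ 2 ≤ s ^ 4) (t : ℝ) :
    ‖∫ x : Fin n → EuclideanSpace ℝ (Fin p),
        Complex.exp (Complex.I * (t * studGCov x y)) ∂(Measure.pi fun _ => F)
      - Complex.exp (-(t : ℂ) ^ 2 / 2)‖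
    ≤ |t| * (|t| * (1 / 2 * √(20 * (64 / c ^ 4 * s ^ 4) + 4 * (64 / c ^ 4 * s ^ 4)))
        + t ^ 2 * (1 / 4 * (s ^ 2 * (2 + √(20 * (64 / c ^ 4 * s ^ 4) + 4 * (64 / c ^ 4 * s ^ 4)))
          + 3 * (64 / c ^ 4) * s ^ 2)))
      + (10 * s
        + |t| * s * √(1 + √(20 * (64 / c ^ 4 * s ^ 4) + 4 * (64 / c ^ 4 * s ^ 4)))) := by
  have hd := isDegenerate_dcd hF
  have hn' : (6 : ℝ) ≤ n := by exact_mod_cast hn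
  set m := dcdMoment F 2 with hm
  set v := weightVar y with hv
  have hv0 : 2 / (n : ℝ) ^ 2 ≤ v := two_div_sq_le_weightVar hK hy
  have hvpos : 0 < v := lt_of_lt_of_le (by positivity) hv0
  set σ := √(v * m) with hσ
  have hσ0 : 0 < σ := Real.sqrt_pos.2 (mul_pos hvpos hpos)
  have hσ2 : σ ^ 2 = v * m := Real.sq_sqrt (mul_pos hvpos hpos).le
  set w : Fin n → Fin n → ℝ := fun i j => giniWeight y i j / σ with hw
  have hws : ∀ i j, w i j = w j i := fun i j => by simp only [hw, giniWeight_symm y i j]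
  set W : ℝ := 4 / (c * (n : ℝ) ^ 2) / σ with hWdef
  have hW : ∀ i j, |w i j| ≤ W := fun i j => by
    rw [hw, hWdef, abs_div, abs_of_pos hσ0]
    exact div_le_div_of_nonneg_right (abs_giniWeight_le hc hy hcy i j) hσ0.le
  have hnorm : (∑ q : Fin n × Fin n with q.1 ≠ q.2, w q.1 q.2 ^ 2)
      * kernelMoment F (dcd F) 2 = 2 := by
    simp only [hw, div_pow]
    rw [← Finset.sum_div, sum_giniWeight_sq (by omega) hy, hσ2]
    change 2 * v / (v * m) * m = 2
    field_simp
  -- Here 64 = 4⁴/2²: the fourth power of the weight bound 4/(cn²), divided by (n²v)² ≥ 4.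
  have hW4 : W ^ 4 * (n : ℝ) ^ 4 ≤ 64 / c ^ 4 / m ^ 2 := by
    have e : W ^ 4 * (n : ℝ) ^ 4 = 256 / (c ^ 4 * (n ^ 2 * v) ^ 2 * m ^ 2) := by
      have : σ ^ 4 = (v * m) ^ 2 := by rw [← hσ2]; ring
      rw [hWdef, div_pow, this]
      field_simp
      norm_num
    have h2 : 2 ≤ (n : ℝ) ^ 2 * v := by
      rwa [div_le_iff₀ (by positivity), mul_comm] at hv0
    have h3 : 4 ≤ ((n : ℝ) ^ 2 * v) ^ 2 := by nlinarith
    rw [e, div_div, div_le_div_iff₀ (by positivity) (by positivity)]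
    have : 0 ≤ 64 * (c ^ 4 * m ^ 2) := by positivity
    nlinarith
  have hC : 0 ≤ 64 / c ^ 4 := by positivity
  have hm4 : 0 ≤ dcdMoment F 4 := hd.kernelMoment_four_nonneg
  have hA : W ^ 4 * (Fintype.card (Fin n) : ℝ) ^ 3 * kernelMoment F (dcd F) 4
      ≤ 64 / c ^ 4 * s ^ 4 := by
    rw [Fintype.card_fin]
    calc W ^ 4 * (n : ℝ) ^ 3 * kernelMoment F (dcd F) 4
        = W ^ 4 * (n : ℝ) ^ 4 * (dcdMoment F 4 / n) := by
          change W ^ 4 * (n : ℝ) ^ 3 * dcdMoment F 4 = _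
          field_simp
      _ ≤ 64 / c ^ 4 / m ^ 2 * (dcdMoment F 4 / n) :=
          mul_le_mul_of_nonneg_right hW4 (by positivity)
      _ = 64 / c ^ 4 * (dcdMoment F 4 / (n * m ^ 2)) := by field_simp
      _ ≤ _ := mul_le_mul_of_nonneg_left h4 hC
  have hB : W ^ 4 * (Fintype.card (Fin n) : ℝ) ^ 4 * |kernelCycle F (dcd F)|
      ≤ 64 / c ^ 4 * s ^ 4 := by
    rw [Fintype.card_fin]
    calc W ^ 4 * (n : ℝ) ^ 4 * |kernelCycle F (dcd F)|
        ≤ 64 / c ^ 4 / m ^ 2 * |dcdCycle F| := mul_le_mul_of_nonneg_right hW4 (abs_nonneg _)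
      _ = 64 / c ^ 4 * (|dcdCycle F| / m ^ 2) := by field_simp
      _ ≤ _ := mul_le_mul_of_nonneg_left hcyc hC
  -- With δ = s², both δ Σ E R_j² and Σ E R_j⁴/δ are of order s², since the fourth moments are of
  -- order s⁴.
  have hmain := hd.norm_charFun_stat_sub_le hws hW hnorm hA hB (δ := s ^ 2) (by positivity) t
  have hT := hd.integral_abs_stat_le hws hW hnorm hA hB
  have hTi : Integrable (fun x : Fin n → EuclideanSpace ℝ (Fin p) => |stat w (dcd F) x|)
      (Measure.pi fun _ => F) := ((hd.memLp_stat w).integrable one_le_two).abs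
  obtain ⟨hVi, hVb⟩ := integral_abs_dVarn_sub_le hF hn
  have hR : ∀ x : Fin n → EuclideanSpace ℝ (Fin p),
      |dVarn x / m - 1| = |dVarn x - m| / m := fun x => by
    rw [← abs_of_pos hpos, ← abs_div, abs_of_pos hpos, sub_div, div_self hpos.ne']
  have hRi : Integrable (fun x : Fin n → EuclideanSpace ℝ (Fin p) => |dVarn x / m - 1|)
      (Measure.pi fun _ => F) := by
    simp only [hR]; exact hVi.div_const m
  have hRb : ∫ x : Fin n → EuclideanSpace ℝ (Fin p), |dVarn x / m - 1| ∂(Measure.pi fun _ => F)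
      ≤ 5 * s ^ 2 := by
    simp only [hR]
    rw [integral_div, div_le_iff₀ hpos]
    refine hVb.trans ?_
    -- After division by m, the fluctuation contributes 4s² and the bias 12/n ≤ s², together 5s².
    have e : √(4 * n ^ 3 * dcdMoment F 4) ≤ 2 * n ^ 2 * m * s ^ 2 := by
      rw [← Real.sqrt_sq (by positivity : 0 ≤ 2 * (n : ℝ) ^ 2 * m * s ^ 2)]
      refine Real.sqrt_le_sqrt ?_
      rw [div_le_iff₀ (by positivity)] at h4
      have : 0 ≤ 4 * (n : ℝ) ^ 3 := by positivity
      nlinarith [mul_le_mul_of_nonneg_left h4 this]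
    have e2 : 12 ≤ s ^ 2 * n := by rwa [div_le_iff₀ (by linarith)] at hns
    rw [div_mul_eq_mul_div, div_le_iff₀ (by positivity)]
    have : 0 ≤ n * m * (s ^ 2 * n - 12) := mul_nonneg (by positivity) (by linarith)
    nlinarith
  have hstud : ∀ x : Fin n → EuclideanSpace ℝ (Fin p),
      studGCov x y = stat w (dcd F) x / √(dVarn x / m) := fun x => by
    rw [hw, stat_giniWeight_eq hF hy, studGCov, div_div, hσ, ← Real.sqrt_mul (by positivity)]
    congr 2
    change v * dVarn x = _
    field_simp
  have hms := measurable_studGCov (p := p) y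
  have hmst := hd.measurable_stat w
  have hint : ∀ {g : (Fin n → EuclideanSpace ℝ (Fin p)) → ℝ}, Measurable g →
      Integrable (fun x => Complex.exp (Complex.I * (t * g x))) (Measure.pi fun _ => F) :=
    fun hg => (integrable_const (1 : ℝ)).mono' (Measurable.aestronglyMeasurable (by fun_prop))
      (ae_of_all _ fun x => (norm_exp_I_mul_mul _ _).le)
  have hdiff : ‖∫ x : Fin n → EuclideanSpace ℝ (Fin p),
        Complex.exp (Complex.I * (t * studGCov x y)) ∂(Measure.pi fun _ => F)
      - ∫ x : Fin n → EuclideanSpace ℝ (Fin p),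
        Complex.exp (Complex.I * (t * stat w (dcd F) x)) ∂(Measure.pi fun _ => F)‖
      ≤ 10 * s
        + |t| * s * √(1 + √(20 * (64 / c ^ 4 * s ^ 4) + 4 * (64 / c ^ 4 * s ^ 4))) := by
    -- Studentizing with ε = s costs (2/s)·5s² = 10s plus |t| s E|T|.
    rw [← integral_sub (hint hms) (hint hmst)]
    refine (norm_integral_le_of_norm_le ((hRi.const_mul (2 / s)).add (hTi.const_mul (|t| * s)))
      (ae_of_all _ fun x => ?_)).trans ?_
    · rw [hstud]
      exact norm_exp_div_sqrt_sub_le t _ _ hs hs1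
    · rw [integral_add' (hRi.const_mul _) (hTi.const_mul _), integral_const_mul,
        integral_const_mul]
      refine add_le_add ?_ (mul_le_mul_of_nonneg_left hT (by positivity))
      refine (mul_le_mul_of_nonneg_left hRb (by positivity)).trans_eq ?_
      field_simp; norm_num
  have e3 : 3 * (64 / c ^ 4 * s ^ 4) / s ^ 2 = 3 * (64 / c ^ 4) * s ^ 2 := by
    field_simp
  rw [e3] at hmain
  refine (norm_sub_le_norm_sub_add_norm_sub _ _ _).trans ((add_le_add hdiff hmain).trans_eq ?_)
  ring

/-- Uniformly over all label vectors with class proportions bounded away from zero, the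
studentized Gini covariance is asymptotically standard Gaussian. -/
theorem exists_norm_charFun_studGCov_sub_le (hK : 2 ≤ K) {c : ℝ} (hc : 0 < c) (t : ℝ) {η : ℝ}
    (hη : 0 < η) : ∃ δ : ℝ, 0 < δ ∧ ∃ N : ℕ, ∀ n, N ≤ n → ∀ (p : ℕ)
      (F : Measure (EuclideanSpace ℝ (Fin p))) [IsProbabilityMeasure F],
      Integrable (fun x => ‖x‖ ^ 4) F → 0 < dcdMoment F 2 →
      dcdMoment F 4 / (n * dcdMoment F 2 ^ 2) ≤ δ → |dcdCycle F| / dcdMoment F 2 ^ 2 ≤ δ →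
      ∀ y : Fin n → Fin K, (∀ k, c * n ≤ clsSize y k) →
      ‖∫ x : Fin n → EuclideanSpace ℝ (Fin p),
          Complex.exp (Complex.I * (t * studGCov x y)) ∂(Measure.pi fun _ => F)
        - Complex.exp (-(t : ℂ) ^ 2 / 2)‖ ≤ η := by
  set G : ℝ → ℝ := fun s =>
    |t| * (|t| * (1 / 2 * √(20 * (64 / c ^ 4 * s ^ 4) + 4 * (64 / c ^ 4 * s ^ 4)))
        + t ^ 2 * (1 / 4 * (s ^ 2 * (2 + √(20 * (64 / c ^ 4 * s ^ 4) + 4 * (64 / c ^ 4 * s ^ 4)))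
          + 3 * (64 / c ^ 4) * s ^ 2)))
      + (10 * s
        + |t| * s * √(1 + √(20 * (64 / c ^ 4 * s ^ 4) + 4 * (64 / c ^ 4 * s ^ 4)))) with hG
  -- The error bound is continuous in s and vanishes at 0, so one small s serves all samples at
  -- once.
  have hGc : Continuous G := by
    simp only [hG]
    fun_prop
  have hG0 : G 0 = 0 := by simp [hG]
  have hev : ∀ᶠ s in 𝓝[>] (0 : ℝ), G s < η ∧ 0 < s ∧ s < 1 / 2 := by
    have h1 : ∀ᶠ s in 𝓝 (0 : ℝ), G s < η :=
      hGc.continuousAt.eventually_lt continuousAt_const (by rwa [hG0])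
    have h2 : ∀ᶠ s in 𝓝 (0 : ℝ), s < 1 / 2 := eventually_lt_nhds (by norm_num)
    filter_upwards [h1.filter_mono nhdsWithin_le_nhds, h2.filter_mono nhdsWithin_le_nhds,
      self_mem_nhdsWithin] with s a b e
    exact ⟨a, e, b⟩
  obtain ⟨s, hs1, hs2, hs3⟩ := hev.exists
  -- The sample size must reach 6, make 12/n ≤ s², and force cn ≥ 2 so that every class contains a
  -- pair.
  refine ⟨s ^ 4, by positivity, max 6 (max ⌈12 / s ^ 2⌉₊ ⌈2 / c⌉₊), ?_⟩
  intro n hn p F _ hF hpos h4 hcyc y hy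
  have hn6 : 6 ≤ n := (le_max_left _ _).trans hn
  have hn1 : 12 / s ^ 2 ≤ n := (Nat.le_ceil _).trans
    (by exact_mod_cast ((le_max_left _ _).trans (le_max_right _ _)).trans hn)
  have hn2 : 2 / c ≤ n := (Nat.le_ceil _).trans
    (by exact_mod_cast ((le_max_right _ _).trans (le_max_right _ _)).trans hn)
  have hn' : (6 : ℝ) ≤ n := by exact_mod_cast hn6
  refine (norm_charFun_studGCov_sub_le hK hF hpos hn6 (fun k => ?_) hc hy hs2 hs3.le ?_ h4 hcyc
    t).trans hs1.le
  · rw [div_le_iff₀ hc] at hn2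
    have : (2 : ℝ) ≤ clsSize y k := by linarith [hy k]
    exact_mod_cast this
  · rw [div_le_iff₀ (by positivity)] at hn1 ⊢
    linarith

end Studentized

/-! ### Class sizes of random labels -/

section Labels

variable {n K : ℕ}

/-- Chebyshev's inequality for the size of one class. -/
theorem measure_clsSize_lt_le (ν : Measure (Fin K)) [IsProbabilityMeasure ν] {c : ℝ} (hc : 0 < c)
    (hn : 0 < n) {k : Fin K} (hk : 2 * c ≤ ν.real {k}) :
    (Measure.pi fun _ : Fin n => ν) {y | (clsSize y k : ℝ) < c * n}
      ≤ ENNReal.ofReal (1 / (n * c ^ 2)) := by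
  have hn' : (0 : ℝ) < n := by exact_mod_cast hn
  set f : Fin K → ℝ := fun l => if k = l then 1 else 0 with hf
  have hfb : ∀ᵐ l ∂ν, f l ∈ Set.Icc (0 : ℝ) 1 := ae_of_all _ fun l => by
    simp only [hf]; split_ifs <;> simp
  have hfm : MemLp f 2 ν := MemLp.of_bound (measurable_of_finite f).aestronglyMeasurable 1
    (ae_of_all _ fun l => by simp only [hf]; split_ifs <;> simp)
  have hfi : ∫ l, f l ∂ν = ν.real {k} := by
    have : f = Set.indicator {k} 1 := by
      funext l; simp [hf, Set.indicator, eq_comm]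
    rw [this, integral_indicator_one (measurableSet_singleton k)]
  set S : (Fin n → Fin K) → ℝ := ∑ i, fun y => f (y i) with hS
  have hSe : ∀ y, S y = clsSize y k := fun y => by
    rw [clsSize_eq_sum, hS, Finset.sum_apply]
  have hfm' : ∀ i : Fin n, MemLp (fun y : Fin n → Fin K => f (y i)) 2 (Measure.pi fun _ => ν) :=
    fun i => hfm.comp_measurePreserving (measurePreserving_eval (fun _ : Fin n => ν) i)
  have hSm : MemLp S 2 (Measure.pi fun _ => ν) := memLp_finsetSum' _ fun i _ => hfm' i
  -- The class size is a sum of independent indicators, each of variance at most 1.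
  have hvar : variance S (Measure.pi fun _ => ν) ≤ n := by
    rw [hS, variance_sum_pi fun _ => hfm]
    have : ∀ i ∈ (Finset.univ : Finset (Fin n)), variance f ν ≤ 1 := fun i _ => by
      refine (variance_le_sub_mul_sub hfb (measurable_of_finite f).aemeasurable).trans ?_
      nlinarith [sq_nonneg (∫ l, f l ∂ν - 1 / 2)]
    exact (Finset.sum_le_card_nsmul _ _ _ this).trans_eq (by simp)
  have hmean : ∫ y, S y ∂(Measure.pi fun _ => ν) = n * ν.real {k} := by
    simp only [hS, Finset.sum_apply]
    rw [integral_finsetSum _ fun i _ => (hfm' i).integrable one_le_two]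
    have : ∀ i : Fin n, ∫ y : Fin n → Fin K, f (y i) ∂(Measure.pi fun _ => ν) = ν.real {k} :=
      fun i => by
        have h := measurePreserving_eval (fun _ : Fin n => ν) i
        rw [← hfi]
        exact h.hasLaw.integral_comp (measurable_of_finite f).aestronglyMeasurable
    simp [this]
  -- The mean is at least 2cn, so falling below cn is a deviation of at least cn.
  have hsub : {y : Fin n → Fin K | (clsSize y k : ℝ) < c * n}
      ⊆ {y | c * n ≤ |S y - ∫ y, S y ∂(Measure.pi fun _ => ν)|} := fun y hy => by
    simp only [Set.mem_ofPred_eq] at hy ⊢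
    rw [hmean, hSe, abs_sub_comm]
    refine le_trans ?_ (le_abs_self _)
    nlinarith
  refine (measure_mono hsub).trans ((meas_ge_le_variance_div_sq hSm (by positivity)).trans
    (ENNReal.ofReal_le_ofReal ?_))
  calc _ ≤ (n : ℝ) / (c * n) ^ 2 := by gcongr
    _ = 1 / (n * c ^ 2) := by field_simp

theorem measure_exists_clsSize_lt_le (ν : Measure (Fin K)) [IsProbabilityMeasure ν] {c : ℝ}
    (hc : 0 < c) (hn : 0 < n) (hk : ∀ k, 2 * c ≤ ν.real {k}) :
    (Measure.pi fun _ : Fin n => ν).real {y | ¬ ∀ k, c * n ≤ (clsSize y k : ℝ)}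
      ≤ K / c ^ 2 / n := by
  have hn' : (0 : ℝ) < n := by exact_mod_cast hn
  have hsub : {y : Fin n → Fin K | ¬ ∀ k, c * n ≤ (clsSize y k : ℝ)}
      ⊆ ⋃ k, {y | (clsSize y k : ℝ) < c * n} := fun y hy => by
    simpa using hy
  refine (measureReal_mono hsub).trans ((measureReal_iUnion_fintype_le _).trans ?_)
  have : ∀ k ∈ (Finset.univ : Finset (Fin K)),
      (Measure.pi fun _ : Fin n => ν).real {y | (clsSize y k : ℝ) < c * n} ≤ 1 / (n * c ^ 2) :=
    fun k _ => ENNReal.toReal_le_of_le_ofReal (by positivity) (measure_clsSize_lt_le ν hc hn (hk k))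
  refine (Finset.sum_le_card_nsmul _ _ _ this).trans_eq ?_
  simp
  field_simp

end Labels

/-! ### Lévy's continuity theorem and joint laws of samples and labels -/

/-- Convergence to a standard Gaussian law from the convergence of characteristic functions. -/
theorem tendstoInDistribution_gaussian {Ω : ℕ → Type*} [∀ m, MeasurableSpace (Ω m)]
    {P : ∀ m, Measure (Ω m)} [∀ m, IsProbabilityMeasure (P m)] {Z : ∀ m, Ω m → ℝ}
    (hZ : ∀ m, Measurable (Z m))
    (h : ∀ t : ℝ, ∀ η : ℝ, 0 < η → ∀ᶠ m in atTop,
      ‖∫ ω, Complex.exp (Complex.I * (t * Z m ω)) ∂(P m) - Complex.exp (-(t : ℂ) ^ 2 / 2)‖ ≤ η) :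
    TendstoInDistribution Z atTop (id : ℝ → ℝ) P (gaussianReal 0 1) := by
  refine ⟨fun m => (hZ m).aemeasurable, aemeasurable_id, ?_⟩
  refine ProbabilityMeasure.tendsto_iff_tendsto_charFun.2 fun t => ?_
  have e1 : charFun ((gaussianReal 0 1).map id) t = Complex.exp (-(t : ℂ) ^ 2 / 2) := by
    rw [Measure.map_id, charFun_gaussianReal]
    congr 1
    push_cast
    ring
  have e2 : ∀ m, charFun ((P m).map (Z m)) t
      = ∫ ω, Complex.exp (Complex.I * (t * Z m ω)) ∂(P m) := fun m => by
    rw [charFun_apply_real, integral_map (hZ m).aemeasurable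
      (Measurable.aestronglyMeasurable (by fun_prop))]
    congr 1; funext ω; congr 1; ring
  change Tendsto (fun m => charFun ((P m).map (Z m)) t) atTop
    (𝓝 (charFun ((gaussianReal 0 1).map id) t))
  rw [e1, Metric.tendsto_atTop']
  intro ε hε
  obtain ⟨N, hN⟩ := eventually_atTop.1 (h t (ε / 2) (by positivity))
  refine ⟨N, fun m hm => ?_⟩
  rw [dist_eq_norm, e2]
  exact (hN m hm.le).trans_lt (by linarith)

section Law

variable {Ω E : Type*} [MeasurableSpace Ω] [MeasurableSpace E] {P : Measure Ω}
  [IsProbabilityMeasure P] {n K : ℕ} {F : Measure E} [IsProbabilityMeasure F]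

omit [IsProbabilityMeasure F] in
theorem map_sample_eq {X : Fin n → Ω → E} (hX : ∀ i, Measurable (X i))
    (hlaw : ∀ i, P.map (X i) = F) (hind : iIndepFun X P) :
    P.map (fun ω i => X i ω) = Measure.pi fun _ => F := by
  rw [(iIndepFun_iff_map_fun_eq_pi_map fun i => (hX i).aemeasurable).1 hind]
  simp only [hlaw]

/-- Each pair has a product law, so the pairs have law (F × ν)ⁿ, which rearranges to Fⁿ × νⁿ. The
whole X sample is thus independent of the whole label vector, and the labels may be frozen. -/
theorem map_sample_prod_eq {ν : Measure (Fin K)} [IsProbabilityMeasure ν] {X : Fin n → Ω → E}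
    {Y : Fin n → Ω → Fin K} (hX : ∀ i, Measurable (X i)) (hY : ∀ i, Measurable (Y i))
    (hXlaw : ∀ i, P.map (X i) = F) (hYlaw : ∀ i, P.map (Y i) = ν)
    (hind : iIndepFun (fun i ω => (X i ω, Y i ω)) P) (hXY : ∀ i, IndepFun (X i) (Y i) P) :
    P.map (fun ω => (fun i => X i ω, fun i => Y i ω))
      = (Measure.pi fun _ => F).prod (Measure.pi fun _ => ν) := by
  have h1 : P.map (fun ω i => (X i ω, Y i ω)) = Measure.pi fun _ => F.prod ν := by
    refine map_sample_eq (fun i => (hX i).prodMk (hY i)) (fun i => ?_) hind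
    rw [(indepFun_iff_map_prod_eq_prod_map_map (hX i).aemeasurable (hY i).aemeasurable).1 (hXY i),
      hXlaw, hYlaw]
  have h2 := measurePreserving_arrowProdEquivProdArrow E (Fin K) (Fin n) (fun _ => F) (fun _ => ν)
  rw [← h2.map_eq, ← h1, Measure.map_map h2.measurable
    (measurable_pi_lambda _ fun i => (hX i).prodMk (hY i))]
  rfl

end Law

/-- Averaging a uniform bound over random labels. -/
theorem norm_integral_prod_sub_le {α β : Type*} [MeasurableSpace α] [MeasurableSpace β]
    {μ : Measure α} [IsProbabilityMeasure μ] {ν : Measure β} [IsProbabilityMeasure ν]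
    {f : α × β → ℂ} (hf : Measurable f) (hf1 : ∀ q, ‖f q‖ ≤ 1) {z : ℂ} (hz : ‖z‖ ≤ 1)
    {s : Set β} (hs : MeasurableSet s) {η : ℝ} (hη : 0 ≤ η)
    (h : ∀ b ∉ s, ‖∫ a, f (a, b) ∂μ - z‖ ≤ η) :
    ‖∫ q, f q ∂(μ.prod ν) - z‖ ≤ η + 2 * ν.real s := by
  have hi : Integrable f (μ.prod ν) :=
    (integrable_const (1 : ℝ)).mono' hf.aestronglyMeasurable (ae_of_all _ hf1)
  rw [integral_prod_symm _ hi]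
  have e : ∫ b, ∫ a, f (a, b) ∂μ ∂ν - z = ∫ b, (∫ a, f (a, b) ∂μ - z) ∂ν := by
    rw [integral_sub hi.integral_prod_right (integrable_const _)]
    simp
  have hb : Integrable (fun b => η + s.indicator (fun _ => (2 : ℝ)) b) ν :=
    (integrable_const _).add ((integrable_const _).indicator hs)
  rw [e]
  refine (norm_integral_le_of_norm_le hb (ae_of_all _ fun b => ?_)).trans_eq ?_
  · by_cases hbs : b ∈ s
    · rw [Set.indicator_of_mem hbs]
      -- On the exceptional labels both the integral and `z` have norm at most 1, whence the factor
      -- 2.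
      have h1 : ‖∫ a, f (a, b) ∂μ‖ ≤ 1 :=
        (norm_integral_le_of_norm_le_const (ae_of_all _ fun a => hf1 (a, b))).trans_eq (by simp)
      linarith [norm_sub_le (∫ a, f (a, b) ∂μ) z]
    · rw [Set.indicator_of_notMem hbs, add_zero]
      exact h b hbs
  · rw [integral_add (integrable_const _) ((integrable_const _).indicator hs),
      integral_indicator_const _ hs]
    simp [mul_comm]

theorem norm_exp_neg_sq_le_one (t : ℝ) : ‖Complex.exp (-(t : ℂ) ^ 2 / 2)‖ ≤ 1 := by
  have : -(t : ℂ) ^ 2 / 2 = ((-t ^ 2 / 2 : ℝ) : ℂ) := by push_cast; ring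
  rw [this, ← Complex.ofReal_exp, Complex.norm_real, Real.norm_eq_abs, Real.abs_exp,
    Real.exp_le_one_iff]
  nlinarith [sq_nonneg t]

/-- There are finitely many label vectors, so measurability for each fixed one suffices. -/
theorem measurable_studGCov_uncurry {p n K : ℕ} :
    Measurable fun q : (Fin n → EuclideanSpace ℝ (Fin p)) × (Fin n → Fin K) =>
      studGCov q.1 q.2 :=
  measurable_from_prod_countable_left fun y => measurable_studGCov y

theorem measurable_studGCov_comp {Ω : Type*} [MeasurableSpace Ω] {p n K : ℕ}
    {X : Fin n → Ω → EuclideanSpace ℝ (Fin p)} {Y : Fin n → Ω → Fin K}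
    (hX : ∀ i, Measurable (X i)) (hY : ∀ i, Measurable (Y i)) :
    Measurable fun ω => studGCov (fun i => X i ω) (fun i => Y i ω) := by
  have h : Measurable fun ω => (fun i => X i ω, fun i => Y i ω) :=
    (measurable_pi_lambda _ hX).prodMk (measurable_pi_lambda _ hY)
  have h' := measurable_studGCov_uncurry.comp h
  simpa only [Function.comp_def] using h'

end GiniCov

/-! ### The limit theorem for random and for fixed labels -/

open GiniCov in
theorem theorem2
    -- number of classes and the fixed law of the label, charging every class
    (K : ℕ) (hK : 2 ≤ K) (pY : PMF (Fin K)) (hpY : ∀ k, pY k ≠ 0)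
    -- the `m`-th sample has size `n m`, dimension `p m`, and law `F m` of the numerical variable
    (n p : ℕ → ℕ) (hp : Tendsto p atTop atTop)
    (F : ∀ m, Measure (EuclideanSpace ℝ (Fin (p m)))) [∀ m, IsProbabilityMeasure (F m)]
    (Ω : ℕ → Type*) [∀ m, MeasurableSpace (Ω m)]
    (P : ∀ m, Measure (Ω m)) [∀ m, IsProbabilityMeasure (P m)]
    (X : ∀ m, Fin (n m) → Ω m → EuclideanSpace ℝ (Fin (p m)))
    (Y : ∀ m, Fin (n m) → Ω m → Fin K)
    (hX : ∀ m i, Measurable (X m i)) (hY : ∀ m i, Measurable (Y m i))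
    (hXlaw : ∀ m i, (P m).map (X m i) = F m)
    (hYlaw : ∀ m i, (P m).map (Y m i) = pY.toMeasure)
    -- the pairs `(X_i, Y_i)` are independent, and `X` is independent of `Y`
    (hiid : ∀ m, iIndepFun (fun i ω => (X m i ω, Y m i ω)) (P m))
    (hXY : ∀ m i, IndepFun (X m i) (Y m i) (P m))
    -- `X` is not almost surely constant, so that the quotients below are meaningful
    (hpos : ∀ m, 0 < GiniCov.dcdMoment (F m) 2)
    (C1 : ∀ m, Integrable (fun x => ‖x‖ ^ 4) (F m))
    (C2 : Tendsto (fun m => GiniCov.dcdMoment (F m) 4 / (n m * GiniCov.dcdMoment (F m) 2 ^ 2))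
      atTop (𝓝 0))
    (C3 : Tendsto (fun m => GiniCov.dcdCycle (F m) / GiniCov.dcdMoment (F m) 2 ^ 2)
      atTop (𝓝 0)) :
    -- random labels: the smallest class size tends to infinity in probability
    ((∀ M : ℕ, Tendsto (fun m => P m {ω | ∀ k, M ≤ GiniCov.clsSize (fun i => Y m i ω) k})
        atTop (𝓝 1)) →
      TendstoInDistribution
        (fun m ω => GiniCov.studGCov (fun i => X m i ω) (fun i => Y m i ω))
        atTop (id : ℝ → ℝ) P (gaussianReal 0 1)) ∧
    -- labels fixed by design, the class proportions being bounded away from zero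
    (∀ y : ∀ m, Fin (n m) → Fin K,
      (∀ M : ℕ, ∀ᶠ m in atTop, ∀ k, M ≤ GiniCov.clsSize (y m) k) →
      (∃ c : ℝ, 0 < c ∧ ∀ᶠ m in atTop, ∀ k, c * n m ≤ GiniCov.clsSize (y m) k) →
      TendstoInDistribution
        (fun m ω => GiniCov.studGCov (fun i => X m i ω) (y m))
        atTop (id : ℝ → ℝ) P (gaussianReal 0 1)) := by
  have C3' : Tendsto (fun m => |dcdCycle (F m)| / dcdMoment (F m) 2 ^ 2) atTop (𝓝 0) := by
    have := C3.abs
    simpa only [abs_div, abs_zero, abs_pow, sq_abs] using this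
  have hXi : ∀ m, iIndepFun (X m) (P m) := fun m =>
    (hiid m).comp (fun _ => Prod.fst) fun _ => measurable_fst
  have hXm : ∀ m, Measurable fun ω i => X m i ω := fun m => measurable_pi_lambda _ (hX m)
  have hYm : ∀ m, Measurable fun ω i => Y m i ω := fun m => measurable_pi_lambda _ (hY m)
  -- Uniformity in `y` is essential: the label vector varies with the outcome in the random case.
  have huniform : ∀ c : ℝ, 0 < c → Tendsto n atTop atTop → ∀ t η : ℝ, 0 < η → ∀ᶠ m in atTop,
      ∀ y : Fin (n m) → Fin K, (∀ k, c * n m ≤ clsSize y k) →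
      ‖∫ x : Fin (n m) → EuclideanSpace ℝ (Fin (p m)),
          Complex.exp (Complex.I * (t * studGCov x y)) ∂(Measure.pi fun _ => F m)
        - Complex.exp (-(t : ℂ) ^ 2 / 2)‖ ≤ η := by
    intro c hc hn t η hη
    obtain ⟨δ, hδ, N, hN⟩ := exists_norm_charFun_studGCov_sub_le hK hc t hη
    filter_upwards [hn.eventually_ge_atTop N, C2.eventually_le_const hδ,
      C3'.eventually_le_const hδ] with m h1 h2 h3 y hy
    exact hN (n m) h1 (p m) (F m) (C1 m) (hpos m) h2 h3 y hy
  constructor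
  · intro hlab
    -- An event whose probability tends to 1 is eventually nonempty, and a single outcome with a
    -- class of size at least M already gives n ≥ M.
    have hn : Tendsto n atTop atTop := by
      refine tendsto_atTop.2 fun M => ?_
      filter_upwards [(hlab M).eventually_ne one_ne_zero] with m hm
      obtain ⟨ω, hω⟩ := nonempty_of_measure_ne_zero hm
      exact (hω ⟨0, by omega⟩).trans (clsSize_le _ _)
    -- Half the smallest class probability, which leaves a margin of cn below the expected class
    -- sizes.
    obtain ⟨c, hc, hck⟩ : ∃ c : ℝ, 0 < c ∧ ∀ k, 2 * c ≤ pY.toMeasure.real {k} := by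
      have hpk : ∀ k, 0 < pY.toMeasure.real {k} := fun k => by
        rw [measureReal_def, PMF.toMeasure_apply_singleton _ _ (measurableSet_singleton k)]
        exact ENNReal.toReal_pos (hpY k) (pY.apply_ne_top k)
      have : Nonempty (Fin K) := ⟨⟨0, by omega⟩⟩
      obtain ⟨k₀, hk₀⟩ := Finite.exists_min fun k => pY.toMeasure.real {k}
      exact ⟨pY.toMeasure.real {k₀} / 2, half_pos (hpk k₀), fun k => by linarith [hk₀ k]⟩
    refine tendstoInDistribution_gaussian
      (fun m => measurable_studGCov_comp (hX m) (hY m)) fun t η hη => ?_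
    have hbad : Tendsto (fun m => (K : ℝ) / c ^ 2 / n m) atTop (𝓝 0) :=
      tendsto_const_nhds.div_atTop (tendsto_natCast_atTop_atTop.comp hn)
    -- The good labels use η/2 of the error, and the exceptional ones 2·(η/4).
    filter_upwards [huniform c hc hn t (η / 2) (by positivity), hn.eventually_gt_atTop 0,
      hbad.eventually_le_const (by positivity : 0 < η / 4)] with m h1 h2 h3
    have hlaw := map_sample_prod_eq (hX m) (hY m) (hXlaw m) (hYlaw m) (hiid m) (hXY m)
    have hfm : Measurable fun q : (Fin (n m) → EuclideanSpace ℝ (Fin (p m))) ×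
        (Fin (n m) → Fin K) => Complex.exp (Complex.I * (t * studGCov q.1 q.2)) := by
      have := measurable_studGCov_uncurry (p := p m) (n := n m) (K := K)
      fun_prop
    have hint := integral_map (μ := P m) ((hXm m).prodMk (hYm m)).aemeasurable
      hfm.aestronglyMeasurable
    rw [hlaw] at hint
    rw [← hint]
    refine (norm_integral_prod_sub_le hfm (fun q => (norm_exp_I_mul_mul _ _).le)
      (norm_exp_neg_sq_le_one t) (s := {y | ¬ ∀ k, c * n m ≤ (clsSize y k : ℝ)})
      (Set.toFinite _).measurableSet (by positivity) fun y hy => h1 y (not_not.1 hy)).trans ?_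
    linarith [measure_exists_clsSize_lt_le (n := n m) pY.toMeasure hc h2 hck]
  · rintro y hlab ⟨c, hc, hcy⟩
    have hn : Tendsto n atTop atTop := by
      refine tendsto_atTop.2 fun M => ?_
      filter_upwards [hlab M] with m hm
      exact (hm ⟨0, by omega⟩).trans (clsSize_le _ _)
    refine tendstoInDistribution_gaussian
      (fun m => (measurable_studGCov (y m)).comp (hXm m)) fun t η hη => ?_
    filter_upwards [huniform c hc hn t η hη, hcy] with m h1 h2
    have hms := measurable_studGCov (p := p m) (y m)
    have hint := integral_map (μ := P m) (hXm m).aemeasurable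
      (f := fun x => Complex.exp (Complex.I * (t * studGCov x (y m))))
      (Measurable.aestronglyMeasurable (by fun_prop))
    rw [map_sample_eq (hX m) (hXlaw m) (hXi m)] at hint
    rw [← hint]
    exact h1 (y m) h2
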